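/- **Theorem 1.1.** Let $K$ be a field (of arbitrary cardinality). (a) Let $\alpha:[0,\infty)\to[0,\infty)$ be a weakly increasing function with $\alpha(x)\to\infty$ as $x\to\infty$. Then there is a finitely generated, associative, unital, infinite-dimensional connected graded $K$-algebra $B=\bigoplus_{n\ge 0}B(n)$ (so each $B(n)$ is a $K$-subspace, $B(n)B(m)\subseteq B(n+m)$ for all $n,m\ge 0$, and $B(0)=K$) such that every element of the homogeneous maximal ideal $\bigoplus_{n\ge 1}B(n)$ is nilpotent, every $B(n)$ is finite-dimensional, and $\dim_K B(n)\le n^{\alpha(n)}$ for all sufficiently large $n$. (b) In particular, over every field $K$, countable or not, there is a finitely generated, infinite-dimensional connected graded $K$-algebra $B$ whose homogeneous maximal ideal is nil and which has subexponential growth: for every finite-dimensional $K$-subspace $V\subseteq B$ that contains $1$ and generates $B$ as a $K$-algebra, and every real $c>1$, one has $\dim_K(V^n)\le c^n$ for all sufficiently large $n$, where $V^n$ is the span of all products of $n$ elements of $V$. -/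

import Mathlib

open Filter
open scoped NNReal

universe u

/-- An `ℕ`-graded algebra `B = ⨁ 𝓑 n` over `K` is connected if `B(0) = K`: the structure map
`K → B` is injective and its image is the component of degree zero. -/
def IsConnectedGrading {K B : Type*} [Field K] [Ring B] [Algebra K B]
    (𝓑 : ℕ → Submodule K B) : Prop :=
  Function.Injective (algebraMap K B) ∧ 𝓑 0 = LinearMap.range (Algebra.linearMap K B)

/-- The homogeneous maximal ideal `⨁_{n ≥ 1} B(n)`, as a subspace of `B`. -/
def positivePart {K B : Type*} [Field K] [Ring B] [Algebra K B]
    (𝓑 : ℕ → Submodule K B) : Submodule K B :=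
  ⨆ n : ℕ, ⨆ _ : 1 ≤ n, 𝓑 n

/-- Subexponential growth of a finitely generated algebra: for every finite-dimensional generating
subspace `V` containing `1`, the growth function `n ↦ dim (V ^ n)` is eventually below `c ^ n`,
for each `c > 1`. -/
def HasSubexponentialGrowth (K B : Type*) [Field K] [Ring B] [Algebra K B] : Prop :=
  ∀ V : Submodule K B, Module.Finite K V → (1 : B) ∈ V → Algebra.adjoin K (V : Set B) = ⊤ →
    ∀ c : ℝ, 1 < c → ∀ᶠ n : ℕ in atTop, (Module.finrank K ↥(V ^ n) : ℝ) ≤ c ^ n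

/-!
The algebra is a graded quotient of the free algebra on two letters, constructed through its dual.
Read homogeneous elements as functionals by means of the form `pair`, for which the words are
orthonormal. A `Tower` is a sequence of spaces `P n` of elements of length `2 ^ n` with
`P (n + 1) ≤ P n * P n`, and the quotient is by the ideal `Tower.annihilator` of all `r` such that
every multiple `u * r * v` is orthogonal to every `P n`. It is infinite-dimensional because no
`P n` vanishes.

*Nilpotency over an arbitrary field.* Let `f` be a combination of non-empty words of length at most
`L`. Cutting the words of a high power of `f` at multiples of `2 ^ n` exhibits, at an aligned
position, a window `s * (f ^ k)ᵢ * p` of length `2 ^ n` with short words `s`, `p`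
(`pow_mem_window`). If `P n` is orthogonal to all such windows, then the power of `f` lies in the
annihilator (`Tower.pow_mem_annihilator`). There are infinitely many `f`, but grouping the monomials
of `(∑ tᵢ wᵢ) ^ k` by their exponents in the coefficients `tᵢ` shows that for fixed `L` all these
windows lie in a space whose dimension is polynomial in `2 ^ n` (`exists_constraints`). So each `L`
costs finitely many linear conditions at one level `n`, and these can be met as soon as
`dim (P (n - 1)) ^ 2` exceeds their number (`exists_tower`).

*Growth.* A window of length `m` of an element of `P n` is a suffix followed by a prefix of elements
of dyadic length, and the suffixes of length `a` lie in a product of the spaces `P i` over the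
binary digits of `a`. Hence the component of degree `m` of the quotient has dimension at most
`(m + 1) * (∏ dim (P i)) ^ 2`, the product being over `2 ^ i ≤ m`
(`Tower.finrank_quotientGrading_le`).

*Balance.* The dimension of `P n` is `2` except on rare intervals of levels, one for each `L`, along
which it is roughly squared at each step until it can absorb the conditions for `L`, whereupon it
falls back. Such an interval starting at the level `s` has about `log s` steps and multiplies the
product of the dimensions by a power of `2 ^ s` with exponent depending on `L` only.
If the intervals start late enough, the total exponent stays below any given function tending to
infinity (`exists_weights`).
-/

namespace NilGrowth

/-! ### The free algebra and the form for which words are orthonormal -/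

/-- The free associative algebra on two letters, as the monoid algebra of the free monoid of
binary words. The additive form is used because `AddMonoidAlgebra` comes with gradings. -/
abbrev WordAlgebra (K : Type u) [Field K] : Type u := AddMonoidAlgebra K (FreeAddMonoid Bool)

/-- The length of a word, as a homomorphism of additive monoids. -/
def wordLength : FreeAddMonoid Bool →+ ℕ where
  toFun := FreeAddMonoid.length
  map_zero' := rfl
  map_add' := FreeAddMonoid.length_add

/-- The span of the words of length `n`. -/
abbrev homog (K : Type u) [Field K] (n : ℕ) : Submodule K (WordAlgebra K) :=
  AddMonoidAlgebra.gradeBy K wordLength n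

/-- The finite set of words of length at most `n`. -/
noncomputable def shortWords (n : ℕ) : Finset (FreeAddMonoid Bool) :=
  (List.finite_length_le Bool n).toFinset

variable {K : Type u} [Field K]

theorem mem_shortWords {n : ℕ} {w : FreeAddMonoid Bool} :
    w ∈ shortWords n ↔ wordLength w ≤ n :=
  (Set.Finite.mem_toFinset _).trans Iff.rfl

/-- The word `w` as an element of the free algebra. -/
noncomputable abbrev word (K : Type u) [Field K] (w : FreeAddMonoid Bool) : WordAlgebra K :=
  AddMonoidAlgebra.single w 1

theorem word_add (v w : FreeAddMonoid Bool) : word K (v + w) = word K v * word K w := by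
  simp [word, AddMonoidAlgebra.single_mul_single]

theorem word_zero : word K 0 = 1 := rfl

theorem word_mem_homog (w : FreeAddMonoid Bool) : word K w ∈ homog K (wordLength w) :=
  AddMonoidAlgebra.single_mem_gradeBy _ _ _

theorem eq_sum_words (f : WordAlgebra K) :
    f = ∑ w ∈ f.coeff.support, f.coeff w • word K w := by
  conv_lhs => rw [← AddMonoidAlgebra.sum_coeff_single f]
  rw [Finsupp.sum]
  refine Finset.sum_congr rfl fun w _ => ?_
  simp [word, AddMonoidAlgebra.smul_single]

theorem homog_eq_span (n : ℕ) :
    homog K n = Submodule.span K (word K '' {w | wordLength w = n}) := by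
  apply le_antisymm
  · intro f hf
    rw [eq_sum_words f]
    exact Submodule.sum_mem _ fun w hw => Submodule.smul_mem _ _
      (Submodule.subset_span ⟨w, hf w hw, rfl⟩)
  · rw [Submodule.span_le]
    rintro _ ⟨w, rfl, rfl⟩
    exact word_mem_homog w

theorem span_words : Submodule.span K (Set.range (word K)) = ⊤ := by
  refine eq_top_iff.2 fun f _ => ?_
  rw [eq_sum_words f]
  exact Submodule.sum_mem _ fun w _ => Submodule.smul_mem _ _ (Submodule.subset_span ⟨w, rfl⟩)

theorem finite_homog (n : ℕ) : Module.Finite K (homog K n) := by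
  rw [homog_eq_span]
  refine Module.Finite.span_of_finite K (Set.Finite.image _ ?_)
  exact (shortWords n).finite_toSet.subset fun w hw => by
    simpa [mem_shortWords] using le_of_eq hw

theorem homog_zero : homog K 0 = Submodule.span K {1} := by
  rw [homog_eq_span]
  congr 1
  ext f
  constructor
  · rintro ⟨w, hw, rfl⟩
    rw [show w = 0 from FreeAddMonoid.length_eq_zero.1 hw]; rfl
  · rintro rfl
    exact ⟨0, rfl, rfl⟩

theorem homog_mul_homog_le (m n : ℕ) : homog K m * homog K n ≤ homog K (m + n) :=
  Submodule.mul_le.2 fun _ hx _ hy => SetLike.mul_mem_graded hx hy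

theorem homog_add (m n : ℕ) : homog K (m + n) = homog K m * homog K n := by
  refine le_antisymm ?_ (homog_mul_homog_le m n)
  rw [homog_eq_span, Submodule.span_le]
  rintro _ ⟨w, hw, rfl⟩
  have hw' : (FreeAddMonoid.toList w).length = m + n := hw
  have : w = FreeAddMonoid.ofList ((FreeAddMonoid.toList w).take m)
      + FreeAddMonoid.ofList ((FreeAddMonoid.toList w).drop m) := by
    rw [← FreeAddMonoid.ofList_append, List.take_append_drop, FreeAddMonoid.ofList_toList]
  rw [this, word_add]
  refine Submodule.mul_mem_mul ?_ ?_
  · convert word_mem_homog (K := K) _ using 1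
    change _ = homog K (List.length _)
    congr 1
    change m = (List.take m _).length
    rw [List.length_take]; omega
  · convert word_mem_homog (K := K) _ using 1
    change _ = homog K (List.length _)
    congr 1
    change n = (List.drop m _).length
    rw [List.length_drop]; omega

/-- The symmetric bilinear form on the free algebra for which the words are orthonormal. -/
noncomputable def pair : WordAlgebra K →ₗ[K] WordAlgebra K →ₗ[K] K :=
  LinearMap.mk₂ K (fun f g => f.coeff.sum fun w a => a * g.coeff w)
    (fun f₁ f₂ g => by
      rw [AddMonoidAlgebra.coeff_add]
      exact Finsupp.sum_add_index' (by simp) (by intros; ring))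
    (fun c f g => by
      rw [AddMonoidAlgebra.coeff_smul, Finsupp.sum_smul_index' (by simp), Finsupp.smul_sum]
      simp [mul_assoc])
    (fun f g₁ g₂ => by simp [mul_add, Finsupp.sum_add])
    (fun c f g => by
      rw [Finsupp.smul_sum]
      refine Finsupp.sum_congr fun w _ => ?_
      simp; ring)

theorem pair_word_left (w : FreeAddMonoid Bool) (g : WordAlgebra K) :
    pair (word K w) g = g.coeff w := by
  simp [pair]

open Classical in
theorem pair_word_word (v w : FreeAddMonoid Bool) :
    pair (word K v) (word K w) = if v = w then 1 else 0 := by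
  rw [pair_word_left, AddMonoidAlgebra.coeff_single, Finsupp.single_apply]
  simp [eq_comm]

theorem pair_eq_zero_of_ne {i j : ℕ} (hij : i ≠ j) {f g : WordAlgebra K}
    (hf : f ∈ homog K i) (hg : g ∈ homog K j) : pair f g = 0 := by
  rw [homog_eq_span] at hf hg
  induction hf, hg using Submodule.span_induction₂ with
  | mem_mem x y hx hy =>
    obtain ⟨v, rfl, rfl⟩ := hx
    obtain ⟨w, rfl, rfl⟩ := hy
    rw [pair_word_word, if_neg (by rintro rfl; exact hij rfl)]
  | zero_left => simp
  | zero_right => simp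
  | add_left => simp_all
  | add_right => simp_all
  | smul_left => simp_all
  | smul_right => simp_all

/-- The form is multiplicative on products whose left factors have equal length. -/
theorem pair_mul {j : ℕ} {u h : WordAlgebra K} (hu : u ∈ homog K j) (hh : h ∈ homog K j)
    (v g : WordAlgebra K) : pair (u * v) (h * g) = pair u h * pair v g := by
  have hv : v ∈ Submodule.span K (Set.range (word K)) := span_words (K := K) ▸ trivial
  have hg : g ∈ Submodule.span K (Set.range (word K)) := span_words (K := K) ▸ trivial
  rw [homog_eq_span] at hu hh
  induction hu, hh using Submodule.span_induction₂ with
  | mem_mem x y hx hy =>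
    obtain ⟨a, ha, rfl⟩ := hx
    obtain ⟨b, hb, rfl⟩ := hy
    induction hv, hg using Submodule.span_induction₂ with
    | mem_mem x y hx hy =>
      obtain ⟨c, rfl⟩ := hx
      obtain ⟨d, rfl⟩ := hy
      simp only [← word_add, pair_word_word]
      have : a + c = b + d ↔ a = b ∧ c = d := by
        refine ⟨fun h => ?_, by rintro ⟨rfl, rfl⟩; rfl⟩
        exact List.append_inj h (ha.trans hb.symm)
      by_cases h₁ : a = b <;> by_cases h₂ : c = d <;> simp [this, h₁, h₂]
    | zero_left => simp
    | zero_right => simp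
    | add_left => simp_all [mul_add]
    | add_right => simp_all [mul_add]
    | smul_left => simp_all [mul_left_comm]
    | smul_right => simp_all [mul_left_comm]
  | zero_left => simp
  | zero_right => simp
  | add_left => simp_all [add_mul]
  | add_right => simp_all [add_mul]
  | smul_left => simp_all [mul_assoc]
  | smul_right => simp_all [mul_assoc]

/-- The coefficient of a concatenation of words in a product. -/
theorem coeff_add_mul {j : ℕ} {f : WordAlgebra K} (hf : f ∈ homog K j) (g : WordAlgebra K)
    (v w : FreeAddMonoid Bool) (hv : wordLength v = j) :
    (f * g).coeff (v + w) = f.coeff v * g.coeff w := by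
  rw [← pair_word_left, word_add, pair_mul (hv ▸ word_mem_homog v) hf, pair_word_left,
    pair_word_left]

/-! ### Towers of prescribed dimension -/

theorem finite_mul {A : Type*} [Ring A] [Algebra K A] (P Q : Submodule K A)
    [Module.Finite K P] [Module.Finite K Q] : Module.Finite K ↥(P * Q) :=
  Module.Finite.iff_fg.2 ((Module.Finite.iff_fg.1 ‹_›).mul (Module.Finite.iff_fg.1 ‹_›))

theorem finrank_mul_le {A : Type*} [Ring A] [Algebra K A] (P Q : Submodule K A)
    [Module.Finite K P] [Module.Finite K Q] :
    Module.finrank K ↥(P * Q) ≤ Module.finrank K P * Module.finrank K Q := by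
  rw [← Submodule.mulMap_range, ← Module.finrank_tensorProduct]
  exact LinearMap.finrank_range_le _

/-- Products of linearly independent homogeneous elements of equal length are linearly
independent in the free algebra. -/
theorem linearIndependent_mul {ι : Type*} {j : ℕ} {b : ι → WordAlgebra K}
    (hb : LinearIndependent K b) (hj : ∀ i, b i ∈ homog K j) :
    LinearIndependent K fun i : ι × ι => b i.1 * b i.2 := by
  classical
  rw [linearIndependent_iff'] at hb ⊢
  intro s c hc
  -- Enlarge the index set to a rectangle.
  set t : Finset ι := s.image Prod.fst ∪ s.image Prod.snd with ht
  set c' : ι → ι → K := fun k l => if (k, l) ∈ s then c (k, l) else 0 with hc'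
  have hst : s ⊆ t ×ˢ t := by
    intro x hx
    simp only [ht, Finset.mem_product, Finset.mem_union, Finset.mem_image]
    exact ⟨Or.inl ⟨x, hx, rfl⟩, Or.inr ⟨x, hx, rfl⟩⟩
  have key : ∑ k ∈ t, ∑ l ∈ t, c' k l • (b k * b l) = 0 := by
    rw [← Finset.sum_product', ← hc]
    symm
    refine (Finset.sum_congr rfl fun x hx => ?_).trans (Finset.sum_subset hst ?_)
    · simp [hc', hx]
    · intro x _ hx
      simp [hc', hx]
  have col : ∀ w, ∑ k ∈ t, (∑ l ∈ t, c' k l * (b l).coeff w) • b k = 0 := by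
    intro w
    ext v
    by_cases hv : wordLength v = j
    · have := congrArg (fun f => AddMonoidAlgebra.coeff f (v + w)) key
      simp only [AddMonoidAlgebra.coeff_sum, AddMonoidAlgebra.coeff_smul, Finsupp.coe_finsetSum,
        Finset.sum_apply, Finsupp.smul_apply, coeff_add_mul (hj _) _ _ _ hv,
        smul_eq_mul] at this
      simp only [AddMonoidAlgebra.coeff_sum, AddMonoidAlgebra.coeff_smul, Finsupp.coe_finsetSum,
        Finset.sum_apply, Finsupp.smul_apply, smul_eq_mul, Finset.sum_mul]
      refine Eq.trans ?_ this
      exact Finset.sum_congr rfl fun k _ => Finset.sum_congr rfl fun l _ => by ring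
    · have h0 : ∀ k, (b k).coeff v = 0 := fun k => by
        by_contra h
        exact hv (hj k v (Finsupp.mem_support_iff.2 h))
      simp [AddMonoidAlgebra.coeff_sum, h0]
  have main : ∀ k ∈ t, ∀ l ∈ t, c' k l = 0 := by
    intro k hk
    refine hb t (fun l => c' k l) ?_
    ext w
    have := hb t _ (col w) k hk
    simpa [AddMonoidAlgebra.coeff_sum] using this
  intro x hx
  have := hst hx
  rw [Finset.mem_product] at this
  simpa [hc', hx] using main x.1 this.1 x.2 this.2

theorem sq_finrank_le {j : ℕ} (P : Submodule K (WordAlgebra K)) [Module.Finite K P]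
    (hP : P ≤ homog K j) : Module.finrank K P ^ 2 ≤ Module.finrank K ↥(P * P) := by
  have := finite_mul P P
  let b := Module.finBasis K P
  have hb : LinearIndependent K fun i => (b i : WordAlgebra K) :=
    b.linearIndependent.map' P.subtype (Submodule.ker_subtype P)
  have h := linearIndependent_mul hb fun i => hP (b i).2
  have h' : LinearIndependent K fun i : Fin (Module.finrank K P) × Fin (Module.finrank K P) =>
      (⟨(b i.1 : WordAlgebra K) * b i.2, Submodule.mul_mem_mul (b i.1).2 (b i.2).2⟩ : ↥(P * P)) :=
    LinearIndependent.of_comp (P * P).subtype h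
  simpa [sq] using h'.fintype_card_le_finrank

/-- Finitely many linear conditions cut out of a space `V` a subspace of any dimension `k` for
which `V` has room. -/
theorem exists_orthogonal (V : Submodule K (WordAlgebra K)) [Module.Finite K V]
    (Z : Finset (WordAlgebra K)) (k : ℕ) (hk : k + Z.card ≤ Module.finrank K V) :
    ∃ P ≤ V, Module.finrank K P = k ∧ ∀ z ∈ Z, ∀ g ∈ P, pair z g = 0 := by
  obtain ⟨φ, hφ⟩ : ∃ φ : V →ₗ[K] (Z → K), ∀ x z, φ x z = pair (z : WordAlgebra K) (x : _) :=
    ⟨LinearMap.pi fun z => (pair (z : WordAlgebra K)).comp V.subtype, fun _ _ => rfl⟩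
  have h₁ := φ.finrank_range_add_finrank_ker
  have h₂ : Module.finrank K (LinearMap.range φ) ≤ Z.card := by
    refine (Submodule.finrank_le _).trans ?_
    rw [Module.finrank_fintype_fun_eq_card, Fintype.card_coe]
  have h₃ : k ≤ Module.finrank K (LinearMap.ker φ) := by omega
  obtain ⟨f, hf⟩ := exists_linearIndependent_of_le_finrank h₃
  have hf' : LinearIndependent K fun i => ((f i : V) : WordAlgebra K) := by
    have h := hf.map_injOn (V.subtype ∘ₗ (LinearMap.ker φ).subtype)
      (Subtype.val_injective.comp Subtype.val_injective).injOn
    simpa only [Function.comp_def, LinearMap.comp_apply, Submodule.subtype_apply] using h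
  refine ⟨Submodule.span K (Set.range fun i => ((f i : V) : WordAlgebra K)), ?_, ?_, ?_⟩
  · rw [Submodule.span_le]
    rintro _ ⟨i, rfl⟩
    exact (f i : V).2
  · rw [finrank_span_eq_card hf']; simp
  · intro z hz g hg
    induction hg using Submodule.span_induction with
    | mem x hx =>
      obtain ⟨i, rfl⟩ := hx
      have h : φ (f i) = 0 := (f i).2
      rw [← hφ (f i) ⟨z, hz⟩, h, Pi.zero_apply]
    | zero => simp
    | add => simp_all
    | smul => simp_all

theorem two_le_finrank_homog_one : 2 ≤ Module.finrank K (homog K 1) := by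
  have := finite_homog (K := K) 1
  have h : LinearIndependent K fun b : Bool =>
      (⟨word K (FreeAddMonoid.of b), word_mem_homog (FreeAddMonoid.of b)⟩ : homog K 1) := by
    refine LinearIndependent.of_comp (homog K 1).subtype ?_
    rw [Fintype.linearIndependent_iff]
    intro g hg i
    have := congrArg (fun f => AddMonoidAlgebra.coeff f (FreeAddMonoid.of i)) hg
    cases i <;> simpa [AddMonoidAlgebra.coeff_sum, Finsupp.single_apply,
      FreeAddMonoid.of_injective.eq_iff] using this
  simpa using h.fintype_card_le_finrank

/-- A sequence of spaces of homogeneous elements of length `2 ^ n`, each consisting of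
combinations of products of two elements of the preceding one. Through the form `pair` the
elements are read as functionals on the free algebra. -/
structure Tower (K : Type u) [Field K] where
  /-- The space at level `n`. -/
  space : ℕ → Submodule K (WordAlgebra K)
  le_homog : ∀ n, space n ≤ homog K (2 ^ n)
  succ_le : ∀ n, space (n + 1) ≤ space n * space n

theorem Tower.finite (T : Tower K) (n : ℕ) : Module.Finite K (T.space n) :=
  have := finite_homog (K := K) (2 ^ n)
  Submodule.finiteDimensional_of_le (T.le_homog n)

/-- A tower with prescribed dimensions `p n` and orthogonal to prescribed finite sets `Z n` exists
as soon as the `p n ^ 2` available dimensions always leave room for the conditions. -/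
theorem exists_tower (p : ℕ → ℕ) (Z : ℕ → Finset (WordAlgebra K)) (hp₀ : p 0 ≤ 2)
    (hp : ∀ n, p (n + 1) + (Z (n + 1)).card ≤ p n ^ 2) :
    ∃ T : Tower K, (∀ n, Module.finrank K (T.space n) = p n) ∧
      ∀ n, ∀ z ∈ Z (n + 1), ∀ g ∈ T.space (n + 1), pair z g = 0 := by
  have base : ∃ P ≤ homog K (2 ^ 0), Module.finrank K P = p 0 := by
    have := finite_homog (K := K) 1
    obtain ⟨P, hP, hk, -⟩ := exists_orthogonal (homog K 1) ∅ (p 0)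
      (by simpa using hp₀.trans two_le_finrank_homog_one)
    exact ⟨P, hP, hk⟩
  have step : ∀ n, ∀ P : {P : Submodule K (WordAlgebra K) //
      P ≤ homog K (2 ^ n) ∧ Module.finrank K P = p n},
      ∃ Q : {Q : Submodule K (WordAlgebra K) //
        Q ≤ homog K (2 ^ (n + 1)) ∧ Module.finrank K Q = p (n + 1)},
      Q.1 ≤ P.1 * P.1 ∧ ∀ z ∈ Z (n + 1), ∀ g ∈ Q.1, pair z g = 0 := by
    rintro n ⟨P, hP, hk⟩
    have := finite_homog (K := K) (2 ^ n)
    have : Module.Finite K P := Submodule.finiteDimensional_of_le hP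
    have := finite_mul P P
    obtain ⟨Q, hQ, hk', ho⟩ := exists_orthogonal (P * P) (Z (n + 1)) (p (n + 1))
      ((hp n).trans (hk ▸ sq_finrank_le P hP))
    refine ⟨⟨Q, hQ.trans ?_, hk'⟩, hQ, ho⟩
    rw [pow_succ, mul_two]
    exact (mul_le_mul' hP hP).trans (homog_mul_homog_le _ _)
  choose next hnext using step
  let S : ∀ n, {P : Submodule K (WordAlgebra K) //
      P ≤ homog K (2 ^ n) ∧ Module.finrank K P = p n} :=
    fun n => Nat.rec ⟨base.choose, base.choose_spec⟩ next n
  exact ⟨⟨fun n => (S n).1, fun n => (S n).2.1, fun n => (hnext n (S n)).1⟩,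
    fun n => (S n).2.2, fun n => (hnext n (S n)).2⟩

/-! ### Powers of elements without constant term -/

/-- The powers of all linear combinations of finitely many elements `x i` are combinations of the
same few elements `G τ`, one for each exponent vector: `G τ` is the sum of all products in which
`x i` occurs `τ i` times. -/
theorem exists_pow_sum_eq {A ι : Type*} [Ring A] [Algebra K A] [Fintype ι] [DecidableEq ι]
    (x : ι → A) (k : ℕ) : ∃ G : (ι → ℕ) → A, ∀ t : ι → K, (∑ i, t i • x i) ^ k =
      ∑ τ ∈ Fintype.piFinset fun _ => Finset.range (k + 1), (∏ i, t i ^ τ i) • G τ := by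
  induction k with
  | zero =>
    refine ⟨fun _ => 1, fun t => ?_⟩
    simp
  | succ k ih =>
    obtain ⟨G, hG⟩ := ih
    let B : Finset (ι → ℕ) := Fintype.piFinset fun _ => Finset.range (k + 1)
    let bump : ι × (ι → ℕ) → ι → ℕ := fun q => q.2 + Pi.single q.1 1
    refine ⟨fun τ => ∑ q ∈ Finset.univ ×ˢ B with bump q = τ, x q.1 * G q.2, fun t => ?_⟩
    have hmaps : ∀ q ∈ Finset.univ ×ˢ B, bump q ∈
        Fintype.piFinset fun _ : ι => Finset.range (k + 1 + 1) := by
      intro q hq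
      rw [Finset.mem_product, Fintype.mem_piFinset] at hq
      rw [Fintype.mem_piFinset]
      intro j
      have h₁ := Finset.mem_range.1 (hq.2 j)
      have h₂ : (Pi.single q.1 1 : ι → ℕ) j ≤ 1 := by
        by_cases h : j = q.1
        · subst h; simp
        · simp [Pi.single_eq_of_ne h]
      rw [Finset.mem_range]
      change q.2 j + (Pi.single q.1 1 : ι → ℕ) j < _
      omega
    have hprod : ∀ q : ι × (ι → ℕ), ∏ i, t i ^ bump q i = t q.1 * ∏ i, t i ^ q.2 i := by
      intro q
      simp only [bump, Pi.add_apply, pow_add, Finset.prod_mul_distrib]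
      rw [mul_comm]
      congr 1
      rw [Finset.prod_eq_single q.1 (fun j _ hj => by simp [Pi.single_eq_of_ne hj]) (by simp)]
      simp
    rw [pow_succ', hG, Finset.sum_mul_sum, ← Finset.sum_product',
      ← Finset.sum_fiberwise_of_maps_to hmaps]
    refine Finset.sum_congr rfl fun τ _ => ?_
    rw [Finset.smul_sum]
    refine Finset.sum_congr rfl fun q hq => ?_
    rw [← (Finset.mem_filter.1 hq).2, hprod, smul_mul_smul_comm]

/-- The component of length `i` of an element of the free algebra. -/
noncomputable abbrev component (i : ℕ) : WordAlgebra K →ₗ[K] WordAlgebra K :=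
  GradedAlgebra.proj (homog K) i

theorem component_mem (i : ℕ) (f : WordAlgebra K) : component i f ∈ homog K i :=
  (DirectSum.decompose (homog K) f i).2

theorem eq_sum_of_support_subset {W : Finset (FreeAddMonoid Bool)} {f : WordAlgebra K}
    (hf : f.coeff.support ⊆ W) : f = ∑ w ∈ W, f.coeff w • word K w := by
  refine (eq_sum_words f).trans (Finset.sum_subset hf fun w _ hw => ?_)
  rw [Finsupp.notMem_support_iff.1 hw, zero_smul]

/-- The components of the powers `f ^ k`, for all `f` supported on a fixed set `W` of words at
once, are spanned by a number of elements that is polynomial in the bound `M` on `k`, and so are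
their products with short words on either side. -/
theorem exists_constraints (W : Finset (FreeAddMonoid Bool)) (L M : ℕ) :
    ∃ Z : Finset (WordAlgebra K),
      Z.card ≤ (shortWords L).card ^ 2 * (M + 1) ^ (W.card + 2) ∧
      ∀ f : WordAlgebra K, f.coeff.support ⊆ W → ∀ s ∈ shortWords L, ∀ p ∈ shortWords L,
        ∀ i ≤ M, ∀ k ≤ M, word K s * component i (f ^ k) * word K p ∈
          Submodule.span K (Z : Set (WordAlgebra K)) := by
  classical
  choose G hG using fun k => exists_pow_sum_eq (K := K) (fun w : W => word K (w : _)) k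
  let B : Finset (W → ℕ) := Fintype.piFinset fun _ => Finset.range (M + 1)
  let I := ((shortWords L ×ˢ shortWords L) ×ˢ (Finset.range (M + 1) ×ˢ Finset.range (M + 1))) ×ˢ B
  refine ⟨I.image fun q => word K q.1.1.1 * component q.1.2.1 (G q.1.2.2 q.2) * word K q.1.1.2,
    ?_, ?_⟩
  · refine Finset.card_image_le.trans (le_of_eq ?_)
    simp only [I, B, Finset.card_product, Fintype.card_piFinset, Finset.card_range,
      Finset.prod_const, Finset.card_univ, Fintype.card_coe]
    ring
  · intro f hf s hs p hp i hi k hk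
    have hsum : f = ∑ w : W, f.coeff w • word K (w : _) := by
      conv_lhs => rw [eq_sum_of_support_subset hf]
      rw [← Finset.sum_coe_sort]
    rw [hsum, hG k fun w => f.coeff w, map_sum, Finset.mul_sum, Finset.sum_mul]
    refine Submodule.sum_mem _ fun τ hτ => ?_
    rw [map_smul, mul_smul_comm, smul_mul_assoc]
    refine Submodule.smul_mem _ _ (Submodule.subset_span ?_)
    rw [Finset.mem_coe, Finset.mem_image]
    refine ⟨(((s, p), (i, k)), τ), ?_, rfl⟩
    simp only [I, B, Finset.mem_product, Finset.mem_range, Fintype.mem_piFinset] at hτ ⊢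
    exact ⟨⟨⟨hs, hp⟩, by omega, by omega⟩, fun w => (hτ w).trans_le (by omega)⟩

/-- A word of length at least `c` splits after its first `c` letters. -/
theorem exists_add_eq {c : ℕ} {w : FreeAddMonoid Bool} (hc : c ≤ wordLength w) :
    ∃ p q, p + q = w ∧ wordLength p = c := by
  refine ⟨FreeAddMonoid.ofList ((FreeAddMonoid.toList w).take c),
    FreeAddMonoid.ofList ((FreeAddMonoid.toList w).drop c), ?_, ?_⟩
  · rw [← FreeAddMonoid.ofList_append, List.take_append_drop, FreeAddMonoid.ofList_toList]
  · change (List.take c _).length = c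
    rw [List.length_take]
    exact min_eq_left hc

/-- Every word occurring in `f` is non-empty and has at most `L` letters. -/
def IsPositiveOfLengthLE (L : ℕ) (f : WordAlgebra K) : Prop :=
  ∀ w ∈ f.coeff.support, 1 ≤ wordLength w ∧ wordLength w ≤ L

/-- The span of the words of length at most `L`. -/
noncomputable def shortSpan (K : Type u) [Field K] (L : ℕ) : Submodule K (WordAlgebra K) :=
  Submodule.span K (word K '' (shortWords L : Set (FreeAddMonoid Bool)))

/-- The span of the powers `f ^ k` with `k ≥ m`. -/
noncomputable def powersFrom (f : WordAlgebra K) (m : ℕ) : Submodule K (WordAlgebra K) :=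
  Submodule.span K ((f ^ ·) '' Set.Ici m)

theorem word_mem_homog_one_mul_shortSpan {L : ℕ} {w : FreeAddMonoid Bool} (h₁ : 1 ≤ wordLength w)
    (hL : wordLength w ≤ L) : word K w ∈ homog K 1 * shortSpan K L := by
  obtain ⟨p, q, rfl, hp⟩ := exists_add_eq h₁
  rw [word_add]
  refine Submodule.mul_mem_mul (hp ▸ word_mem_homog p) (Submodule.subset_span ⟨q, ?_, rfl⟩)
  rw [map_add] at hL
  rw [Finset.mem_coe, mem_shortWords]
  omega

theorem IsPositiveOfLengthLE.mem_homog_one_mul {L : ℕ} {f : WordAlgebra K}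
    (hf : IsPositiveOfLengthLE L f) : f ∈ homog K 1 * shortSpan K L := by
  rw [eq_sum_words f]
  exact Submodule.sum_mem _ fun w hw => Submodule.smul_mem _ _
    (word_mem_homog_one_mul_shortSpan (hf w hw).1 (hf w hw).2)

/-- Cutting a power of `f` after its first `c` letters: the cut goes through some factor `f`, whose
remaining part is a combination of short words. -/
theorem pow_mem_cut_left {L : ℕ} {f : WordAlgebra K} (hf : IsPositiveOfLengthLE L f) (c m : ℕ) :
    powersFrom f (m + c) ≤ homog K c * (shortSpan K L * powersFrom f m) := by
  have step : ∀ m, shortSpan K L * powersFrom f (m + 1) ≤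
      homog K 1 * (shortSpan K L * powersFrom f m) := by
    intro m
    rw [shortSpan, powersFrom, Submodule.span_mul_span, Submodule.span_le, ← mul_assoc]
    rintro _ ⟨_, ⟨s, hs, rfl⟩, _, ⟨k, hk, rfl⟩, rfl⟩
    replace hk : m + 1 ≤ k := hk
    rw [Finset.mem_coe, mem_shortWords] at hs
    rcases Nat.eq_zero_or_pos (wordLength s) with h | h
    · rw [show s = 0 from FreeAddMonoid.length_eq_zero.1 h]
      obtain ⟨k, rfl⟩ : ∃ k', k = k' + 1 := ⟨k - 1, by omega⟩
      simp only [word_zero, one_mul, pow_succ']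
      refine Submodule.mul_mem_mul hf.mem_homog_one_mul (Submodule.subset_span ⟨k, ?_, rfl⟩)
      exact Nat.le_of_succ_le_succ hk
    · refine Submodule.mul_mem_mul (word_mem_homog_one_mul_shortSpan h hs)
        (Submodule.subset_span ⟨k, ?_, rfl⟩)
      exact (Nat.le_succ m).trans hk
  induction c generalizing m with
  | zero =>
    intro x hx
    have h₁ : (1 : WordAlgebra K) ∈ homog K 0 := SetLike.one_mem_graded _
    have h₂ : (1 : WordAlgebra K) ∈ shortSpan K L :=
      Submodule.subset_span ⟨0, by simp [mem_shortWords], rfl⟩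
    simpa using Submodule.mul_mem_mul h₁ (Submodule.mul_mem_mul h₂ hx)
  | succ c ih =>
    have := ih (m + 1)
    rw [show m + (c + 1) = m + 1 + c by ring]
    refine this.trans ?_
    rw [homog_add, mul_assoc]
    exact mul_le_mul_right (step m) _

/-- The span of the products `(f ^ k)ᵢ p` of total length `c`, where `k ≤ c`, the word `p` has at
most `L` letters and `(f ^ k)ᵢ` is the component of length `i` of `f ^ k`. -/
noncomputable def cutPrefixes (L : ℕ) (f : WordAlgebra K) (c : ℕ) : Submodule K (WordAlgebra K) :=
  Submodule.span K {x | ∃ k ≤ c, ∃ i, ∃ p ∈ shortWords L, i + wordLength p = c ∧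
    x = component i (f ^ k) * word K p}

theorem component_mul_word (i : ℕ) (g : WordAlgebra K) (w : FreeAddMonoid Bool) :
    component i (g * word K w) =
      if wordLength w ≤ i then component (i - wordLength w) g * word K w else 0 := by
  simp only [component, GradedAlgebra.proj_apply]
  exact DirectSum.coe_decompose_mul_of_right_mem _ _ (word_mem_homog w)

theorem component_pow_eq_zero {L : ℕ} {f : WordAlgebra K} (hf : IsPositiveOfLengthLE L f)
    {i k : ℕ} (h : i < k) : component i (f ^ k) = 0 := by
  induction k generalizing i with
  | zero => omega
  | succ k ih =>
    rw [pow_succ]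
    conv_lhs => rw [eq_sum_words f, Finset.mul_sum, map_sum]
    refine Finset.sum_eq_zero fun w hw => ?_
    have := (hf w hw).1
    rw [mul_smul_comm, map_smul, ← eq_sum_words, component_mul_word]
    split_ifs
    · rw [ih (by omega)]; simp
    · simp

/-- Cutting a power of `f` after its first `c` letters, keeping track of the first part. -/
theorem pow_mem_cut_right {L : ℕ} {f : WordAlgebra K} (hf : IsPositiveOfLengthLE L f) {c : ℕ}
    (hc : 1 ≤ c) {m : ℕ} (hm : c ≤ m) : f ^ m ∈ cutPrefixes L f c * ⊤ := by
  -- What is left after `j` factors: the products whose first `j` factors are shorter than `c`.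
  have key : ∀ j ≤ c, f ^ m - (∑ i ∈ Finset.range c, component i (f ^ j)) * f ^ (m - j) ∈
      cutPrefixes L f c * ⊤ := by
    intro j
    induction j with
    | zero =>
      intro _
      have : ∑ i ∈ Finset.range c, component i (1 : WordAlgebra K) = 1 := by
        rw [Finset.sum_eq_single_of_mem 0 (Finset.mem_range.2 hc)]
        · exact DirectSum.decompose_of_mem_same (homog K) (SetLike.one_mem_graded (homog K))
        · intro i _ hi
          exact DirectSum.decompose_of_mem_ne (homog K) (SetLike.one_mem_graded (homog K)) hi.symm
      rw [pow_zero, this, one_mul, Nat.sub_zero, sub_self]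
      exact zero_mem _
    | succ j ih =>
      intro hj
      have h := ih (by omega)
      rw [show m - j = (m - (j + 1)) + 1 by omega, pow_succ' f (m - (j + 1)), ← mul_assoc] at h
      have step : (∑ i ∈ Finset.range c, component i (f ^ j)) * f -
          ∑ i ∈ Finset.range c, component i (f ^ (j + 1)) ∈ cutPrefixes L f c * ⊤ := by
        have e : (∑ i ∈ Finset.range c, component i (f ^ j)) * f -
            ∑ i ∈ Finset.range c, component i (f ^ j * f) =
            ∑ w ∈ f.coeff.support, f.coeff w •
              ((∑ i ∈ Finset.range c, component i (f ^ j)) * word K w -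
                ∑ i ∈ Finset.range c, component i (f ^ j * word K w)) := by
          generalize f ^ j = g
          conv_lhs => rw [eq_sum_words f]
          simp only [Finset.mul_sum, map_sum, mul_smul_comm, map_smul, smul_sub,
            Finset.sum_sub_distrib, Finset.smul_sum]
          rw [Finset.sum_comm (s := Finset.range c)]
        rw [pow_succ, e]
        refine Submodule.sum_mem _ fun w hw => Submodule.smul_mem _ _ ?_
        have e₂ : ∑ i ∈ Finset.range c, component i (f ^ j * word K w) =
            (∑ i ∈ Finset.range (c - wordLength w), component i (f ^ j)) * word K w := by
          simp only [component_mul_word]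
          rw [← Finset.sum_filter, Finset.sum_mul]
          refine Finset.sum_nbij' (fun i => i - wordLength w) (fun i => i + wordLength w)
            ?_ ?_ ?_ ?_ ?_ <;> intro i hi <;>
            simp only [Finset.mem_filter, Finset.mem_range] at hi ⊢ <;> omega
        rw [e₂, ← sub_mul, ← Finset.sum_Ico_eq_sub _ (Nat.sub_le _ _), Finset.sum_mul]
        refine Submodule.sum_mem _ fun i hi => ?_
        rw [Finset.mem_Ico] at hi
        obtain ⟨p, q, rfl, hp⟩ := exists_add_eq (c := c - i) (w := w) (by omega)
        rw [word_add, ← mul_assoc]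
        refine Submodule.mul_mem_mul (Submodule.subset_span ⟨j, by omega, i, p, ?_, by omega, rfl⟩)
          trivial
        have := (hf _ hw).2
        rw [map_add] at this
        rw [mem_shortWords]
        omega
      have step' := Submodule.mul_mem_mul step (Submodule.mem_top (x := f ^ (m - (j + 1))) (R := K))
      rw [mul_assoc] at step'
      have := Submodule.add_mem _ h (SetLike.le_def.1 (mul_le_mul_right le_top _) step')
      rw [sub_mul] at this
      convert this using 1
      abel
  have h := key c le_rfl
  rwa [Finset.sum_eq_zero fun i hi => component_pow_eq_zero hf (Finset.mem_range.1 hi), zero_mul,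
    sub_zero] at h

/-- If `Z` spans the elements of length `2 ^ n` arising as windows in powers of `f`, then a high
power of `f` has an element of the span of `Z` at every position `c ≤ 2 ^ n`. -/
theorem pow_mem_window {L n : ℕ} {f : WordAlgebra K} (hf : IsPositiveOfLengthLE L f)
    (hL : L < 2 ^ n) {Z : Submodule K (WordAlgebra K)}
    (hZ : ∀ s ∈ shortWords L, ∀ p ∈ shortWords L, ∀ i ≤ 2 ^ n, ∀ k ≤ 2 ^ n,
      word K s * component i (f ^ k) * word K p ∈ Z) {c : ℕ} (hc : c ≤ 2 ^ n) :
    f ^ 2 ^ (n + 1) ∈ homog K c * ((Z ⊓ homog K (2 ^ n)) * ⊤) := by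
  have h₁ : f ^ 2 ^ (n + 1) ∈ powersFrom f (2 ^ n + c) :=
    Submodule.subset_span ⟨_, show 2 ^ n + c ≤ 2 ^ (n + 1) by rw [pow_succ]; omega, rfl⟩
  refine SetLike.le_def.1 (mul_le_mul_right ?_ _) (pow_mem_cut_left hf c (2 ^ n) h₁)
  rw [shortSpan, powersFrom, Submodule.span_mul_span, Submodule.span_le]
  rintro _ ⟨_, ⟨s, hs, rfl⟩, _, ⟨k, hk, rfl⟩, rfl⟩
  replace hk : 2 ^ n ≤ k := hk
  have hs' := mem_shortWords.1 hs
  have h₂ := pow_mem_cut_right hf (c := 2 ^ n - wordLength s) (m := k) (by omega) (by omega)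
  have h₃ : Submodule.map (LinearMap.mulLeft K (word K s)) (cutPrefixes L f (2 ^ n - wordLength s))
      ≤ Z ⊓ homog K (2 ^ n) := by
    rw [cutPrefixes, Submodule.map_span, Submodule.span_le]
    rintro _ ⟨_, ⟨k, hk, i, p, hp, hip, rfl⟩, rfl⟩
    rw [LinearMap.mulLeft_apply, ← mul_assoc]
    refine ⟨hZ s hs p hp i (by omega) k (by omega), ?_⟩
    have : 2 ^ n = wordLength s + i + wordLength p := by omega
    rw [this]
    exact SetLike.mul_mem_graded (SetLike.mul_mem_graded (word_mem_homog s) (component_mem i _))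
      (word_mem_homog p)
  refine Submodule.mul_induction_on
    (C := fun y => word K s * y ∈ (Z ⊓ homog K (2 ^ n)) * (⊤ : Submodule K (WordAlgebra K)))
    h₂ (fun x hx y _ => ?_) fun x y hx hy => ?_
  · rw [← mul_assoc]
    exact Submodule.mul_mem_mul (h₃ ⟨x, hx, rfl⟩) trivial
  · rw [mul_add]
    exact Submodule.add_mem _ hx hy

/-- A space of the tower is contained, at every aligned position, in products with a factor from a
lower space. -/
theorem Tower.le_block (T : Tower K) (n t a : ℕ) (ha : a < 2 ^ t) :
    T.space (n + t) ≤ homog K (a * 2 ^ n) * (T.space n * ⊤) := by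
  have one_le : (1 : Submodule K (WordAlgebra K)) ≤ ⊤ := le_top
  induction t generalizing a with
  | zero =>
    obtain rfl : a = 0 := by simpa using ha
    have h₁ : (1 : Submodule K (WordAlgebra K)) ≤ homog K 0 := by
      rw [Submodule.one_le]; exact SetLike.one_mem_graded _
    simpa using mul_le_mul' h₁ (mul_le_mul' (le_refl (T.space n)) one_le)
  | succ t ih =>
    refine (T.succ_le (n + t)).trans ?_
    rcases lt_or_ge a (2 ^ t) with h | h
    · refine (mul_le_mul' (ih a h) le_top).trans ?_
      rw [mul_assoc, mul_assoc]
      exact mul_le_mul_right (mul_le_mul_right le_top _) _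
    · obtain ⟨b, rfl⟩ := Nat.exists_eq_add_of_le h
      refine (mul_le_mul' (T.le_homog _) (ih b (by rw [pow_succ] at ha; omega))).trans ?_
      rw [add_mul, homog_add, mul_assoc, ← pow_add, add_comm n t]

/-- The ideal of the elements of the free algebra all of whose two-sided multiples are orthogonal to
every space of the tower. -/
def Tower.annihilator (T : Tower K) : Ideal (WordAlgebra K) where
  carrier := {r | ∀ n, ∀ g ∈ T.space n, ∀ u v, pair (u * r * v) g = 0}
  add_mem' {r s} hr hs n g hg u v := by
    rw [mul_add, add_mul, map_add, LinearMap.add_apply, hr n g hg, hs n g hg, add_zero]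
  zero_mem' := by simp
  smul_mem' c r hr n g hg u v := by
    rw [smul_eq_mul, ← mul_assoc]; exact hr n g hg _ v

theorem Tower.mem_annihilator_of_words (T : Tower K) {r : WordAlgebra K}
    (h : ∀ n, ∀ g ∈ T.space n, ∀ x y, pair (word K x * r * word K y) g = 0) :
    r ∈ T.annihilator := by
  intro n g hg u v
  have hu : u ∈ Submodule.span K (Set.range (word K)) := span_words (K := K) ▸ trivial
  have hv : v ∈ Submodule.span K (Set.range (word K)) := span_words (K := K) ▸ trivial
  induction hu, hv using Submodule.span_induction₂ with
  | mem_mem x y hx hy =>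
    obtain ⟨x, rfl⟩ := hx
    obtain ⟨y, rfl⟩ := hy
    exact h n g hg x y
  | zero_left => simp
  | zero_right => simp
  | add_left => simp_all [add_mul]
  | add_right => simp_all [mul_add]
  | smul_left => simp_all
  | smul_right => simp_all

/-- A window of length `2 ^ n` orthogonal to the tower at an aligned position kills a product. -/
theorem Tower.pair_window_eq_zero (T : Tower K) {n : ℕ} {Z : Submodule K (WordAlgebra K)}
    (hZ : ∀ z ∈ Z, ∀ g ∈ T.space n, pair z g = 0) (a m : ℕ) {r g : WordAlgebra K}
    (hr : r ∈ homog K (a * 2 ^ n) * ((Z ⊓ homog K (2 ^ n)) * ⊤)) (hg : g ∈ T.space m) :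
    pair r g = 0 := by
  have hr' : r ∈ homog K (a * 2 ^ n) * ((Z ⊓ homog K (2 ^ n)) *
      Submodule.span K (Set.range (word K))) := by rwa [span_words]
  clear hr
  refine Submodule.mul_induction_on hr' (fun h hh s hs => ?_) fun x y hx hy => by
    rw [map_add, LinearMap.add_apply, hx, hy, add_zero]
  refine Submodule.mul_induction_on hs (fun z hz y hy => ?_) fun x y hx hy => by
    rw [mul_add, map_add, LinearMap.add_apply, hx, hy, add_zero]
  induction hy using Submodule.span_induction with
  | zero => simp
  | add x y _ _ hx hy => rw [mul_add, mul_add, map_add, LinearMap.add_apply, hx, hy, add_zero]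
  | smul c x _ hx => rw [mul_smul_comm, mul_smul_comm, map_smul, LinearMap.smul_apply, hx,
      smul_zero]
  | mem x hx =>
    obtain ⟨y, rfl⟩ := hx
    rcases le_or_gt ((a + 1) * 2 ^ n) (2 ^ m) with hle | hlt
    · have hnm : n ≤ m := by
        by_contra hmn
        have : 2 ^ m < 2 ^ n := Nat.pow_lt_pow_right (by norm_num) (by omega)
        nlinarith [Nat.zero_le (a * 2 ^ n)]
      obtain ⟨t, rfl⟩ := Nat.exists_eq_add_of_le hnm
      have ha : a < 2 ^ t := by
        rw [pow_add, mul_comm] at hle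
        exact Nat.le_of_mul_le_mul_left hle (by positivity)
      refine Submodule.mul_induction_on (T.le_block n t a ha hg) (fun h' hh' s hs => ?_)
        fun x y hx hy => by rw [map_add, hx, hy, add_zero]
      refine Submodule.mul_induction_on hs (fun g' hg' y' _ => ?_)
        fun x y hx hy => by rw [mul_add, map_add, hx, hy, add_zero]
      rw [pair_mul hh hh', pair_mul hz.2 (T.le_homog n hg'), hZ z hz.1 g' hg', zero_mul, mul_zero]
    · refine pair_eq_zero_of_ne (i := a * 2 ^ n + (2 ^ n + wordLength y)) ?_
        (SetLike.mul_mem_graded hh (SetLike.mul_mem_graded hz.2 (word_mem_homog y)))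
        (T.le_homog m hg)
      rw [add_mul] at hlt
      omega

/-- Orthogonality of one space of the tower to the windows of length `2 ^ n` in powers of `f` makes
`f` nilpotent modulo the annihilator. -/
theorem Tower.pow_mem_annihilator (T : Tower K) {L n : ℕ} {f : WordAlgebra K}
    (hf : IsPositiveOfLengthLE L f) (hL : L < 2 ^ n) {Z : Finset (WordAlgebra K)}
    (hZ : ∀ s ∈ shortWords L, ∀ p ∈ shortWords L, ∀ i ≤ 2 ^ n, ∀ k ≤ 2 ^ n,
      word K s * component i (f ^ k) * word K p ∈ Submodule.span K (Z : Set (WordAlgebra K)))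
    (hT : ∀ z ∈ Z, ∀ g ∈ T.space n, pair z g = 0) :
    f ^ 2 ^ (n + 1) ∈ T.annihilator := by
  refine T.mem_annihilator_of_words fun m g hg x y => ?_
  -- The first aligned position at or after the end of `x`, up to one block.
  set a := wordLength x / 2 ^ n + 1 with ha
  have hx := Nat.div_add_mod (wordLength x) (2 ^ n)
  have hx' := Nat.mod_lt (wordLength x) (show 0 < 2 ^ n by positivity)
  have hax : a * 2 ^ n = 2 ^ n * (wordLength x / 2 ^ n) + 2 ^ n := by rw [ha]; ring
  have hwin := pow_mem_window hf hL hZ (c := a * 2 ^ n - wordLength x) (by omega)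
  refine T.pair_window_eq_zero (n := n) (Z := Submodule.span K (Z : Set (WordAlgebra K)))
    ?_ a m ?_ hg
  · intro z hz g hg
    induction hz using Submodule.span_induction with
    | mem z hz => exact hT z hz g hg
    | zero => simp
    | add => simp_all
    | smul => simp_all
  · have h := Submodule.mul_mem_mul (Submodule.mul_mem_mul (word_mem_homog (K := K) x) hwin)
      (Submodule.mem_top (x := word K y) (R := K))
    rw [← mul_assoc (homog K (wordLength x)), ← homog_add, mul_assoc, mul_assoc] at h
    rw [show a * 2 ^ n = wordLength x + (a * 2 ^ n - wordLength x) by omega]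
    exact SetLike.le_def.1 (mul_le_mul_right (mul_le_mul_right le_top _) _) h

/-! ### The graded quotient by the annihilator of a tower and its dimensions -/

/-- The images of the components of a graded algebra in a quotient. -/
def quotientGrading {A : Type*} [Ring A] [Algebra K A] (𝓐 : ℕ → Submodule K A) (I : Ideal A)
    [I.IsTwoSided] (i : ℕ) : Submodule K (A ⧸ I) :=
  (𝓐 i).map (Ideal.Quotient.mkₐ K I).toLinearMap

theorem mem_quotientGrading {A : Type*} [Ring A] [Algebra K A] {𝓐 : ℕ → Submodule K A}
    {I : Ideal A} [I.IsTwoSided] {i : ℕ} {b : A ⧸ I} :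
    b ∈ quotientGrading 𝓐 I i ↔ ∃ a ∈ 𝓐 i, Ideal.Quotient.mk I a = b :=
  Submodule.mem_map

theorem isInternal_quotientGrading {A : Type*} [Ring A] [Algebra K A] (𝓐 : ℕ → Submodule K A)
    [GradedAlgebra 𝓐] (I : Ideal A) [I.IsTwoSided]
    (hI : ∀ r ∈ I, ∀ i, (DirectSum.decompose 𝓐 r i : A) ∈ I) :
    DirectSum.IsInternal (quotientGrading 𝓐 I) := by
  classical
  constructor
  · rw [injective_iff_map_eq_zero]
    intro x hx
    choose a ha hax using fun i => mem_quotientGrading.1 (x i).2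
    rw [DirectSum.coeAddMonoidHom_eq_dfinsuppSum, DFinsupp.sum] at hx
    have hmem : ∑ i ∈ x.support, a i ∈ I := by
      rw [← Ideal.Quotient.eq_zero_iff_mem, map_sum, ← hx]
      exact Finset.sum_congr rfl fun i _ => hax i
    ext i
    by_cases hi : i ∈ x.support
    · have := hI _ hmem i
      rw [DirectSum.decompose_sum, DFinsupp.finsetSum_apply, AddSubmonoidClass.coe_finsetSum,
        Finset.sum_eq_single_of_mem i hi
          fun j _ hj => DirectSum.decompose_of_mem_ne 𝓐 (ha j) hj,
        DirectSum.decompose_of_mem_same 𝓐 (ha i)] at this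
      rw [← hax i, Ideal.Quotient.eq_zero_iff_mem.2 this]; rfl
    · rw [DFinsupp.notMem_support_iff.1 hi]; rfl
  · intro b
    obtain ⟨a, rfl⟩ := Ideal.Quotient.mk_surjective b
    rw [← DirectSum.sum_support_decompose 𝓐 a, map_sum]
    refine ⟨∑ i ∈ (DirectSum.decompose 𝓐 a).support, DirectSum.of _ i
      ⟨Ideal.Quotient.mk I (DirectSum.decompose 𝓐 a i),
        mem_quotientGrading.2 ⟨_, (DirectSum.decompose 𝓐 a i).2, rfl⟩⟩, ?_⟩
    rw [map_sum]
    exact Finset.sum_congr rfl fun i _ => DirectSum.coeAddMonoidHom_of _ _ _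

/-- The quotient of a graded algebra by a homogeneous two-sided ideal is graded. -/
@[reducible] noncomputable def gradedAlgebraQuotient {A : Type*} [Ring A] [Algebra K A] (𝓐 : ℕ → Submodule K A)
    [GradedAlgebra 𝓐] (I : Ideal A) [I.IsTwoSided]
    (hI : ∀ r ∈ I, ∀ i, (DirectSum.decompose 𝓐 r i : A) ∈ I) :
    GradedAlgebra (quotientGrading 𝓐 I) :=
  { (isInternal_quotientGrading 𝓐 I hI).chooseDecomposition with
    one_mem := mem_quotientGrading.2 ⟨1, SetLike.one_mem_graded 𝓐, map_one _⟩
    mul_mem := by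
      intro i j x y hx hy
      obtain ⟨a, ha, rfl⟩ := mem_quotientGrading.1 hx
      obtain ⟨b, hb, rfl⟩ := mem_quotientGrading.1 hy
      exact mem_quotientGrading.2 ⟨a * b, SetLike.mul_mem_graded ha hb, map_mul _ _ _⟩ }

namespace Tower

variable (T : Tower K)

instance : (T.annihilator).IsTwoSided where
  mul_mem_of_left {r} b hr := by
    intro n g hg u v
    rw [← mul_assoc, mul_assoc (u * r)]
    exact hr n g hg u (b * v)

theorem component_mem_annihilator {r : WordAlgebra K} (hr : r ∈ T.annihilator) (i : ℕ) :
    (DirectSum.decompose (homog K) r i : WordAlgebra K) ∈ T.annihilator := by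
  classical
  refine T.mem_annihilator_of_words fun n g hg x y => ?_
  have hdeg : ∀ j, word K x * (DirectSum.decompose (homog K) r j : WordAlgebra K) * word K y ∈
      homog K (wordLength x + j + wordLength y) := fun j =>
    SetLike.mul_mem_graded (SetLike.mul_mem_graded (word_mem_homog x)
      (DirectSum.decompose (homog K) r j).2) (word_mem_homog y)
  by_cases h : wordLength x + i + wordLength y = 2 ^ n
  · have := hr n g hg (word K x) (word K y)
    rw [← DirectSum.sum_support_decompose (homog K) r, Finset.mul_sum, Finset.sum_mul, map_sum,
      LinearMap.sum_apply] at this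
    rw [← this]
    symm
    refine Finset.sum_eq_single i (fun j _ hj => ?_) fun hi => ?_
    · exact pair_eq_zero_of_ne (by omega) (hdeg j) (T.le_homog n hg)
    · rw [DFinsupp.notMem_support_iff.1 hi]; simp
  · exact pair_eq_zero_of_ne h (hdeg i) (T.le_homog n hg)

/-- The span of the ends of length `a < 2 ^ n` of the elements of the tower, enlarged to a product
of spaces of the tower, one for each binary digit `1` of `a`. -/
noncomputable def suffixes : ℕ → ℕ → Submodule K (WordAlgebra K)
  | 0, _ => 1
  | n + 1, a => if a < 2 ^ n then suffixes n a else suffixes n (a - 2 ^ n) * T.space n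

/-- The span of the beginnings of length `a < 2 ^ n` of the elements of the tower, enlarged to a
product of spaces of the tower, one for each binary digit `1` of `a`. -/
noncomputable def prefixes : ℕ → ℕ → Submodule K (WordAlgebra K)
  | 0, _ => 1
  | n + 1, a => if a < 2 ^ n then prefixes n a else T.space n * prefixes n (a - 2 ^ n)

theorem suffixes_of_le {a n n' : ℕ} (ha : a < 2 ^ n) (h : n ≤ n') :
    T.suffixes n' a = T.suffixes n a := by
  induction n', h using Nat.le_induction with
  | base => rfl
  | succ k hk ih =>
    rw [suffixes, if_pos (ha.trans_le (Nat.pow_le_pow_right (by norm_num) hk)), ih]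

theorem prefixes_of_le {a n n' : ℕ} (ha : a < 2 ^ n) (h : n ≤ n') :
    T.prefixes n' a = T.prefixes n a := by
  induction n', h using Nat.le_induction with
  | base => rfl
  | succ k hk ih =>
    rw [prefixes, if_pos (ha.trans_le (Nat.pow_le_pow_right (by norm_num) hk)), ih]

theorem suffixes_eq {a n n' : ℕ} (h : a < 2 ^ n) (h' : a < 2 ^ n') :
    T.suffixes n a = T.suffixes n' a := by
  rcases le_total n n' with hn | hn
  · exact (T.suffixes_of_le h hn).symm
  · exact T.suffixes_of_le h' hn

theorem prefixes_eq {a n n' : ℕ} (h : a < 2 ^ n) (h' : a < 2 ^ n') :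
    T.prefixes n a = T.prefixes n' a := by
  rcases le_total n n' with hn | hn
  · exact (T.prefixes_of_le h hn).symm
  · exact T.prefixes_of_le h' hn

theorem suffixes_zero (n : ℕ) : T.suffixes n 0 = 1 := T.suffixes_of_le (n := 0) (by simp) n.zero_le

theorem prefixes_zero (n : ℕ) : T.prefixes n 0 = 1 := T.prefixes_of_le (n := 0) (by simp) n.zero_le

theorem suffixes_add {n a : ℕ} (ha : a < 2 ^ n) {k : ℕ} (hk : a < 2 ^ k) {k' : ℕ}
    (hk' : 2 ^ n + a < 2 ^ k') : T.suffixes k' (2 ^ n + a) = T.suffixes k a * T.space n := by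
  rw [T.suffixes_eq hk' (n' := n + 1) (by rw [pow_succ]; omega), suffixes, if_neg (by omega),
    Nat.add_sub_cancel_left, T.suffixes_eq ha hk]

theorem prefixes_add {n a : ℕ} (ha : a < 2 ^ n) {k : ℕ} (hk : a < 2 ^ k) {k' : ℕ}
    (hk' : 2 ^ n + a < 2 ^ k') : T.prefixes k' (2 ^ n + a) = T.space n * T.prefixes k a := by
  rw [T.prefixes_eq hk' (n' := n + 1) (by rw [pow_succ]; omega), prefixes, if_neg (by omega),
    Nat.add_sub_cancel_left, T.prefixes_eq ha hk]

theorem suffixes_two_pow {n k : ℕ} (hk : 2 ^ n < 2 ^ k) : T.suffixes k (2 ^ n) = T.space n := by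
  simpa [suffixes_zero] using T.suffixes_add (n := n) (a := 0) (by positivity) (k := 0) (by simp) hk

theorem prefixes_two_pow {n k : ℕ} (hk : 2 ^ n < 2 ^ k) : T.prefixes k (2 ^ n) = T.space n := by
  simpa [prefixes_zero] using T.prefixes_add (n := n) (a := 0) (by positivity) (k := 0) (by simp) hk

theorem one_le_homog_zero : (1 : Submodule K (WordAlgebra K)) ≤ homog K 0 :=
  Submodule.one_le.2 (SetLike.one_mem_graded (homog K))

theorem space_le_suffixes {n j a : ℕ} (h : j + a = 2 ^ n) {k : ℕ} (hk : a < 2 ^ k) :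
    T.space n ≤ homog K j * T.suffixes k a := by
  induction n generalizing j a k with
  | zero =>
    rcases Nat.eq_zero_or_pos a with rfl | ha
    · obtain rfl : j = 2 ^ 0 := by omega
      rw [suffixes_zero, mul_one]
      exact T.le_homog 0
    · obtain rfl : a = 2 ^ 0 := by rw [pow_zero] at h ⊢; omega
      obtain rfl : j = 0 := by omega
      rw [T.suffixes_two_pow hk]
      simpa using mul_le_mul_left one_le_homog_zero (T.space 0)
  | succ n ih =>
    rw [pow_succ] at h
    rcases le_or_gt (2 ^ n) j with hj | hj
    · obtain ⟨j, rfl⟩ := Nat.exists_eq_add_of_le hj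
      rw [homog_add, mul_assoc]
      exact (T.succ_le n).trans (mul_le_mul' (T.le_homog n) (ih (by omega) hk))
    · obtain ⟨b, rfl⟩ : ∃ b, a = 2 ^ n + b := Nat.exists_eq_add_of_le (by omega)
      rcases Nat.eq_zero_or_pos j with rfl | hj'
      · obtain rfl : b = 2 ^ n := by omega
        rw [← mul_two, ← pow_succ] at hk ⊢
        rw [T.suffixes_two_pow hk]
        simpa using mul_le_mul_left one_le_homog_zero (T.space (n + 1))
      · rw [T.suffixes_add (a := b) (by omega) (k := n) (by omega) hk, ← mul_assoc]
        exact (T.succ_le n).trans (mul_le_mul' (ih (by omega) (by omega)) le_rfl)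

theorem space_le_prefixes {n j a : ℕ} (h : a + j = 2 ^ n) {k : ℕ} (hk : a < 2 ^ k) :
    T.space n ≤ T.prefixes k a * homog K j := by
  induction n generalizing j a k with
  | zero =>
    rcases Nat.eq_zero_or_pos a with rfl | ha
    · obtain rfl : j = 2 ^ 0 := by omega
      rw [prefixes_zero, one_mul]
      exact T.le_homog 0
    · obtain rfl : a = 2 ^ 0 := by rw [pow_zero] at h ⊢; omega
      obtain rfl : j = 0 := by omega
      rw [T.prefixes_two_pow hk]
      simpa using mul_le_mul_right one_le_homog_zero (T.space 0)
  | succ n ih =>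
    rw [pow_succ] at h
    rcases le_or_gt (2 ^ n) j with hj | hj
    · obtain ⟨j, rfl⟩ := Nat.exists_eq_add_of_le hj
      rw [add_comm (2 ^ n) j, homog_add, ← mul_assoc]
      exact (T.succ_le n).trans (mul_le_mul' (ih (by omega) hk) (T.le_homog n))
    · obtain ⟨b, rfl⟩ : ∃ b, a = 2 ^ n + b := Nat.exists_eq_add_of_le (by omega)
      rcases Nat.eq_zero_or_pos j with rfl | hj'
      · obtain rfl : b = 2 ^ n := by omega
        rw [← mul_two, ← pow_succ] at hk ⊢
        rw [T.prefixes_two_pow hk]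
        simpa using mul_le_mul_right one_le_homog_zero (T.space (n + 1))
      · rw [T.prefixes_add (a := b) (by omega) (k := n) (by omega) hk, mul_assoc]
        exact (T.succ_le n).trans (mul_le_mul' le_rfl (ih (a := b) (j := j) (by omega) (by omega)))

/-- A space containing all windows of length `m < 2 ^ k` of elements of the tower: a window across
the middle of a dyadic block consists of a suffix and a prefix of the two halves. -/
noncomputable def windows (k m : ℕ) : Submodule K (WordAlgebra K) :=
  ⨆ a ∈ Finset.range (m + 1), T.suffixes k a * T.prefixes k (m - a)

theorem suffixes_mul_prefixes_le_windows (k a b : ℕ) :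
    T.suffixes k a * T.prefixes k b ≤ T.windows k (a + b) := by
  have := le_iSup₂_of_le (f := fun i (_ : i ∈ Finset.range (a + b + 1)) =>
    T.suffixes k i * T.prefixes k (a + b - i)) a (by simp) le_rfl
  simpa [windows] using this

/-- Every window of length `m` of an element of the tower lies in `windows k m`: pass to the smallest
dyadic block that contains its position. -/
theorem space_le_windows {n j m l k : ℕ} (h : j + m + l = 2 ^ n) (hm : 1 ≤ m) (hk : m < 2 ^ k) :
    T.space n ≤ homog K j * (T.windows k m * homog K l) := by
  induction n generalizing j l with
  | zero =>
    rw [pow_zero] at h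
    obtain rfl : j = 0 := by omega
    obtain rfl : l = 0 := by omega
    obtain rfl : m = 2 ^ 0 := by rw [pow_zero]; omega
    have h₁ : T.space 0 ≤ T.windows k (2 ^ 0) := by
      have := T.suffixes_mul_prefixes_le_windows k (2 ^ 0) 0
      rwa [T.suffixes_two_pow hk, prefixes_zero, mul_one] at this
    simpa using mul_le_mul' one_le_homog_zero (mul_le_mul' h₁ one_le_homog_zero)
  | succ n ih =>
    rw [pow_succ] at h
    refine (T.succ_le n).trans ?_
    rcases le_or_gt (2 ^ n) j with hj | hj
    · obtain ⟨j, rfl⟩ := Nat.exists_eq_add_of_le hj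
      rw [homog_add, mul_assoc]
      exact mul_le_mul' (T.le_homog n) (ih (by omega))
    rcases le_or_gt (2 ^ n) l with hl | hl
    · obtain ⟨l, rfl⟩ := Nat.exists_eq_add_of_le hl
      rw [add_comm (2 ^ n) l, homog_add, ← mul_assoc (T.windows k m), ← mul_assoc]
      exact mul_le_mul' (ih (by omega)) (T.le_homog n)
    · obtain ⟨a, ha⟩ := Nat.exists_eq_add_of_le hj.le
      obtain ⟨b, hb⟩ := Nat.exists_eq_add_of_le hl.le
      obtain rfl : m = a + b := by omega
      refine (mul_le_mul' (T.space_le_suffixes ha.symm (k := k) (by omega))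
        (T.space_le_prefixes (a := b) (j := l) (by omega) (k := k) (by omega))).trans ?_
      rw [mul_assoc, ← mul_assoc (T.suffixes k a)]
      exact mul_le_mul_right (mul_le_mul_left (T.suffixes_mul_prefixes_le_windows k a b) _) _

/-- In degree `m` orthogonality to the windows of length `m` suffices for annihilating the tower. -/
theorem mem_annihilator_of_pair_windows {m k : ℕ} (hm : 1 ≤ m) (hk : m < 2 ^ k)
    (hwin : T.windows k m ≤ homog K m) {r : WordAlgebra K}
    (hr : r ∈ homog K m) (h : ∀ c ∈ T.windows k m, pair r c = 0) : r ∈ T.annihilator := by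
  refine T.mem_annihilator_of_words fun n g hg x y => ?_
  by_cases hn : wordLength x + m + wordLength y = 2 ^ n
  · refine Submodule.mul_induction_on (T.space_le_windows hn hm hk hg) (fun h' hh' s hs => ?_)
      fun x y hx hy => by rw [map_add, hx, hy, add_zero]
    refine Submodule.mul_induction_on hs (fun c hc y' _ => ?_)
      fun x y hx hy => by rw [mul_add, map_add, hx, hy, add_zero]
    rw [mul_assoc, pair_mul (word_mem_homog x) hh', pair_mul hr (hwin hc), h c hc, zero_mul,
      mul_zero]
  · exact pair_eq_zero_of_ne hn (SetLike.mul_mem_graded (SetLike.mul_mem_graded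
      (word_mem_homog x) hr) (word_mem_homog y)) (T.le_homog n hg)

theorem suffixes_le_homog {n a : ℕ} (ha : a < 2 ^ n) : T.suffixes n a ≤ homog K a := by
  induction n generalizing a with
  | zero =>
    obtain rfl : a = 0 := by simpa using ha
    exact one_le_homog_zero
  | succ n ih =>
    rw [suffixes]
    split_ifs with h
    · exact ih h
    · obtain ⟨b, rfl⟩ := Nat.exists_eq_add_of_le (not_lt.1 h)
      rw [Nat.add_sub_cancel_left, add_comm, homog_add]
      exact mul_le_mul' (ih (by rw [pow_succ] at ha; omega)) (T.le_homog n)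

theorem prefixes_le_homog {n a : ℕ} (ha : a < 2 ^ n) : T.prefixes n a ≤ homog K a := by
  induction n generalizing a with
  | zero =>
    obtain rfl : a = 0 := by simpa using ha
    exact one_le_homog_zero
  | succ n ih =>
    rw [prefixes]
    split_ifs with h
    · exact ih h
    · obtain ⟨b, rfl⟩ := Nat.exists_eq_add_of_le (not_lt.1 h)
      rw [Nat.add_sub_cancel_left, homog_add]
      exact mul_le_mul' (T.le_homog n) (ih (by rw [pow_succ] at ha; omega))

theorem windows_le_homog {k m : ℕ} (hk : m < 2 ^ k) : T.windows k m ≤ homog K m := by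
  refine iSup₂_le fun a ha => ?_
  rw [Finset.mem_range] at ha
  calc _ ≤ homog K a * homog K (m - a) :=
        mul_le_mul' (T.suffixes_le_homog (by omega)) (T.prefixes_le_homog (by omega))
    _ = homog K m := by rw [← homog_add]; congr 1; omega

theorem finrank_suffixes_le (hT : ∀ n, 1 ≤ Module.finrank K (T.space n)) (n a : ℕ) :
    Module.Finite K (T.suffixes n a) ∧ Module.finrank K (T.suffixes n a) ≤
      ∏ i ∈ Finset.range n, Module.finrank K (T.space i) := by
  induction n generalizing a with
  | zero =>
    rw [suffixes, Submodule.one_eq_span]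
    refine ⟨inferInstance, ?_⟩
    simpa using finrank_span_le_card (R := K) ({1} : Set (WordAlgebra K))
  | succ n ih =>
    have := T.finite n
    rw [Finset.prod_range_succ]
    rcases lt_or_ge a (2 ^ n) with h | h
    · rw [show T.suffixes (n + 1) a = T.suffixes n a from if_pos h]
      exact ⟨(ih a).1, (ih a).2.trans (Nat.le_mul_of_pos_right _ (hT n))⟩
    · rw [show T.suffixes (n + 1) a = T.suffixes n (a - 2 ^ n) * T.space n from if_neg h.not_gt]
      have := (ih (a - 2 ^ n)).1
      exact ⟨finite_mul _ _, (finrank_mul_le _ _).trans (Nat.mul_le_mul_right _ (ih (a - 2 ^ n)).2)⟩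

theorem finrank_prefixes_le (hT : ∀ n, 1 ≤ Module.finrank K (T.space n)) (n a : ℕ) :
    Module.Finite K (T.prefixes n a) ∧ Module.finrank K (T.prefixes n a) ≤
      ∏ i ∈ Finset.range n, Module.finrank K (T.space i) := by
  induction n generalizing a with
  | zero =>
    rw [prefixes, Submodule.one_eq_span]
    refine ⟨inferInstance, ?_⟩
    simpa using finrank_span_le_card (R := K) ({1} : Set (WordAlgebra K))
  | succ n ih =>
    have := T.finite n
    rw [Finset.prod_range_succ]
    rcases lt_or_ge a (2 ^ n) with h | h
    · rw [show T.prefixes (n + 1) a = T.prefixes n a from if_pos h]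
      exact ⟨(ih a).1, (ih a).2.trans (Nat.le_mul_of_pos_right _ (hT n))⟩
    · rw [show T.prefixes (n + 1) a = T.space n * T.prefixes n (a - 2 ^ n) from if_neg h.not_gt, mul_comm _ (Module.finrank K (T.space n))]
      have := (ih (a - 2 ^ n)).1
      exact ⟨finite_mul _ _, (finrank_mul_le _ _).trans (Nat.mul_le_mul_left _ (ih (a - 2 ^ n)).2)⟩

end Tower

theorem finrank_biSup_le {V ι : Type*} [AddCommGroup V] [Module K V] (s : Finset ι)
    (W : ι → Submodule K V) (hW : ∀ i, Module.Finite K (W i)) :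
    Module.Finite K ↥(⨆ i ∈ s, W i) ∧
      Module.finrank K ↥(⨆ i ∈ s, W i) ≤ ∑ i ∈ s, Module.finrank K (W i) := by
  classical
  induction s using Finset.induction_on with
  | empty =>
    rw [show ⨆ i ∈ (∅ : Finset ι), W i = ⊥ by simp]
    exact ⟨inferInstance, by simp⟩
  | insert a s ha ih =>
    rw [Finset.iSup_insert, Finset.sum_insert ha]
    have := ih.1
    have := hW a
    exact ⟨inferInstance, (Submodule.finrank_add_le_finrank_add_finrank _ _).trans
      (Nat.add_le_add_left ih.2 _)⟩

namespace Tower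

variable (T : Tower K)

theorem finrank_windows_le (hT : ∀ n, 1 ≤ Module.finrank K (T.space n)) (k m : ℕ) :
    Module.Finite K (T.windows k m) ∧ Module.finrank K (T.windows k m) ≤
      (m + 1) * (∏ i ∈ Finset.range k, Module.finrank K (T.space i)) ^ 2 := by
  have hfin : ∀ a, Module.Finite K ↥(T.suffixes k a * T.prefixes k (m - a)) := fun a =>
    have := (T.finrank_suffixes_le hT k a).1
    have := (T.finrank_prefixes_le hT k (m - a)).1
    finite_mul _ _
  have h := finrank_biSup_le (Finset.range (m + 1)) (fun a => T.suffixes k a * T.prefixes k (m - a))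
    hfin
  refine ⟨h.1, h.2.trans ?_⟩
  refine (Finset.sum_le_card_nsmul _ _
    ((∏ i ∈ Finset.range k, Module.finrank K (T.space i)) ^ 2) fun a _ => ?_).trans (by simp)
  have := (T.finrank_suffixes_le hT k a).1
  have := (T.finrank_prefixes_le hT k (m - a)).1
  rw [sq]
  exact (finrank_mul_le _ _).trans
    (Nat.mul_le_mul (T.finrank_suffixes_le hT k a).2 (T.finrank_prefixes_le hT k (m - a)).2)

/-- The dimension of a component of the quotient by the annihilator is at most that of the space of
windows. -/
theorem finrank_quotientGrading_le (hT : ∀ n, 1 ≤ Module.finrank K (T.space n)) {m k : ℕ}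
    (hm : 1 ≤ m) (hk : m < 2 ^ k) :
    Module.finrank K (quotientGrading (homog K) T.annihilator m) ≤
      (m + 1) * (∏ i ∈ Finset.range k, Module.finrank K (T.space i)) ^ 2 := by
  have := finite_homog (K := K) m
  have hfin := (T.finrank_windows_le hT k m).1
  refine le_trans ?_ (T.finrank_windows_le hT k m).2
  obtain ⟨φ, hφ⟩ : ∃ φ : homog K m →ₗ[K] Module.Dual K (T.windows k m),
      ∀ r c, φ r c = pair (r : WordAlgebra K) (c : WordAlgebra K) :=
    ⟨(LinearMap.lcomp K K (T.windows k m).subtype).comp (pair.comp (homog K m).subtype),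
      fun _ _ => rfl⟩
  let ψ : homog K m →ₗ[K] WordAlgebra K ⧸ T.annihilator :=
    (Ideal.Quotient.mkₐ K T.annihilator).toLinearMap.comp (homog K m).subtype
  have hker : LinearMap.ker φ ≤ LinearMap.ker ψ := by
    intro r hr
    refine Ideal.Quotient.eq_zero_iff_mem.2
      (T.mem_annihilator_of_pair_windows hm hk (T.windows_le_homog hk) r.2 fun c hc => ?_)
    have h := hφ r ⟨c, hc⟩
    rw [LinearMap.mem_ker.1 hr, LinearMap.zero_apply] at h
    exact h.symm
  have hrange : quotientGrading (homog K) T.annihilator m = LinearMap.range ψ := by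
    rw [LinearMap.range_comp, Submodule.range_subtype]; rfl
  have h₁ := φ.finrank_range_add_finrank_ker
  have h₂ := ψ.finrank_range_add_finrank_ker
  have h₃ := Submodule.finrank_mono hker
  have h₄ := Submodule.finrank_le (LinearMap.range φ)
  rw [Subspace.dual_finrank_eq] at h₄
  rw [hrange]
  omega

end Tower

/-! ### The exponents of the dimensions -/

theorem mul_add_two_le_two_pow (s : ℕ) : s * (s + 2) ≤ 2 ^ (s + 1) := by
  rcases Nat.lt_or_ge s 2 with h | h
  · interval_cases s <;> norm_num
  · induction s, h using Nat.le_induction with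
    | base => norm_num
    | succ s hs ih => rw [pow_succ]; nlinarith

/-- A number of doublings, about `log s` for fixed `c`, that suffices for absorbing
`2 ^ (c * (s + e + 2))` conditions at their end. -/
theorem exists_window_length {c s : ℕ} (hc : 1 ≤ c) (hcs : c ≤ s) :
    ∃ e, c * (s + e + 2) ≤ 2 ^ e ∧ 2 ^ e ≤ 4 * (c * (s + 2)) := by
  set x := 2 * (c * (s + 2)) with hx
  have h1 : 1 ≤ c * (s + 2) := Nat.mul_pos hc (by omega)
  have hx2 : 1 < x := by omega
  have h₁ := Nat.le_pow_clog (b := 2) (by norm_num) x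
  have h₂ := Nat.pow_pred_clog_lt_self (b := 2) (by norm_num) hx2
  have h₃ : Nat.clog 2 x ≤ s + 2 := by
    refine Nat.clog_le_of_le_pow ?_
    have := mul_add_two_le_two_pow s
    have h := Nat.mul_le_mul_right (s + 2) hcs
    rw [pow_succ]
    omega
  have h₄ : 1 ≤ Nat.clog 2 x := Nat.clog_pos (by norm_num) hx2
  refine ⟨Nat.clog 2 x, ?_, ?_⟩
  · refine le_trans ?_ h₁
    calc c * (s + Nat.clog 2 x + 2) ≤ c * (2 * (s + 2)) := Nat.mul_le_mul_left _ (by omega)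
      _ = x := by rw [hx]; ring
  · obtain ⟨e, he⟩ : ∃ e, Nat.clog 2 x = e + 1 := ⟨Nat.clog 2 x - 1, by omega⟩
    rw [he, Nat.pred_succ] at h₂
    rw [he, pow_succ]
    omega

/-- The weight contributed at level `i` by a window of doublings that starts at `s` and has
length `e`. -/
def windowWeight (s e i : ℕ) : ℕ := if s ≤ i ∧ i ≤ s + e then 2 ^ (i - s) else 0

/-- Along a window the weight doubles. It appears out of nothing only at the start of the window, and
its last doubling is left over for other purposes. -/
theorem windowWeight_succ_add_le (s e n : ℕ) :
    windowWeight s e (n + 1) + (if s + e + 1 = n + 1 then 2 ^ (e + 1) else 0) ≤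
      2 * windowWeight s e n + if s = n + 1 then 1 else 0 := by
  unfold windowWeight
  rcases lt_trichotomy s (n + 1) with h | rfl | h
  · rw [if_neg h.ne]
    rcases lt_trichotomy (s + e) n with h' | rfl | h'
    · rw [if_neg (by omega), if_neg (by omega)]; simp
    · rw [if_neg (by omega), if_pos rfl, if_pos (by omega), Nat.add_sub_cancel_left, pow_succ]
      omega
    · rw [if_pos (by omega), if_neg (by omega), if_pos (by omega),
        show n + 1 - s = (n - s) + 1 by omega, pow_succ]
      omega
  · rw [if_pos (by omega), if_neg (by omega), if_neg (by omega), if_pos rfl]; simp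
  · rw [if_neg (by omega), if_neg (by omega)]; simp

theorem sum_windowWeight_lt (s e N : ℕ) :
    ∑ i ∈ Finset.range N, windowWeight s e i < 2 ^ min (N - s) (e + 1) := by
  induction N with
  | zero => simp
  | succ N ih =>
    rw [Finset.sum_range_succ]
    unfold windowWeight at ih ⊢
    split_ifs with h
    · rw [min_eq_left (by omega)] at ih ⊢
      rw [show N + 1 - s = (N - s) + 1 by omega, pow_succ]
      omega
    · refine ih.trans_le (Nat.pow_le_pow_right (by norm_num) ?_)
      omega

/-- The exponents `w n` of the dimensions `2 ^ w n` of a tower. They can absorb, for every `d`,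
fewer than `2 ^ (c d * (ρ d + 1))` linear conditions at the level `ρ d`, while the sum of the first `n` of
them grows only slightly faster than `n`. -/
theorem exists_weights (c L : ℕ → ℕ) (hc : ∀ d, 1 ≤ c d) (b : ℕ → ℝ)
    (hb : Tendsto b atTop atTop) :
    ∃ w ρ : ℕ → ℕ, w 0 ≤ 1 ∧ Function.Injective ρ ∧ (∀ d, L d < ρ d) ∧
      (∀ n, w (n + 1) ≤ 2 * w n) ∧
      (∀ n d, ρ d = n + 1 → w (n + 1) + c d * (n + 2) ≤ 2 * w n) ∧
      ∀ᶠ n : ℕ in atTop, (∑ i ∈ Finset.range (n + 1), w i : ℕ) ≤ n * b n := by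
  set κ : ℕ → ℕ := fun j => ∑ d ∈ Finset.range j, 8 * c d with hκ
  have hg : ∀ d, ∃ g, ∀ n ≥ g, 2 + 3 * (κ (d + 1) : ℝ) ≤ b n := fun d =>
    eventually_atTop.1 (hb.eventually_ge_atTop _)
  choose g hg using hg
  have hE : ∀ d s, ∃ e, c d ≤ s → c d * (s + e + 2) ≤ 2 ^ e ∧ 2 ^ e ≤ 4 * (c d * (s + 2)) := by
    intro d s
    by_cases h : c d ≤ s
    · exact (exists_window_length (hc d) h).imp fun e he _ => he
    · exact ⟨0, fun h' => absurd h' h⟩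
  choose E hE using hE
  -- The windows start so late that the growth bound tolerates them, and they are disjoint.
  obtain ⟨s, hs_zero, hs_succ⟩ : ∃ s : ℕ → ℕ, s 0 = g 0 + c 0 + L 0 + 1 ∧ ∀ d, s (d + 1) =
      g (d + 1) + c (d + 1) + L (d + 1) + s d + E d (s d) + 1 :=
    ⟨fun d => Nat.rec (g 0 + c 0 + L 0 + 1)
      (fun d sd => g (d + 1) + c (d + 1) + L (d + 1) + sd + E d sd + 1) d, rfl, fun _ => rfl⟩
  have hs_ge : ∀ d, g d + c d + L d + 1 ≤ s d := by
    rintro (_ | d)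
    · exact hs_zero.ge
    · rw [hs_succ]; omega
  have hs_mono : StrictMono s := strictMono_nat_of_lt_succ fun d => by rw [hs_succ]; omega
  have hs_gt : ∀ d, d < s d := fun d => by
    induction d with
    | zero => have := hs_ge 0; omega
    | succ d ih => rw [hs_succ]; omega
  set e : ℕ → ℕ := fun d => E d (s d) with he
  have he₁ : ∀ d, c d * (s d + e d + 2) ≤ 2 ^ e d := fun d =>
    (hE d (s d) (by have := hs_ge d; omega)).1
  have he₂ : ∀ d, 2 ^ e d ≤ 4 * (c d * (s d + 2)) := fun d =>
    (hE d (s d) (by have := hs_ge d; omega)).2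
  set w : ℕ → ℕ := fun i => 1 + ∑ d ∈ Finset.range (i + 1), windowWeight (s d) (e d) i with hw
  have key : ∀ n, w (n + 1) + ∑ d ∈ Finset.range (n + 1 + 1),
      (if s d + e d + 1 = n + 1 then 2 ^ (e d + 1) else 0) ≤ 2 * w n := by
    intro n
    have h₁ := Finset.sum_le_sum fun d (_ : d ∈ Finset.range (n + 1 + 1)) =>
      windowWeight_succ_add_le (s d) (e d) n
    rw [Finset.sum_add_distrib, Finset.sum_add_distrib, ← Finset.mul_sum] at h₁
    have h₂ : ∑ d ∈ Finset.range (n + 1 + 1), windowWeight (s d) (e d) n =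
        ∑ d ∈ Finset.range (n + 1), windowWeight (s d) (e d) n := by
      rw [Finset.sum_range_succ, windowWeight, if_neg, add_zero]
      have := hs_gt (n + 1)
      omega
    have h₃ : ∑ d ∈ Finset.range (n + 1 + 1), (if s d = n + 1 then 1 else 0 : ℕ) ≤ 1 := by
      rw [← Finset.card_filter, Finset.card_le_one]
      intro x hx y hy
      exact hs_mono.injective ((Finset.mem_filter.1 hx).2.trans (Finset.mem_filter.1 hy).2.symm)
    rw [h₂] at h₁
    simp only [hw]
    omega
  refine ⟨w, fun d => s d + e d + 1, ?_, ?_, ?_, fun n => ?_, ?_, ?_⟩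
  · simp only [hw, zero_add, Finset.sum_range_one, windowWeight]
    rw [if_neg]
    have := hs_gt 0
    omega
  · refine StrictMono.injective (strictMono_nat_of_lt_succ fun d => ?_)
    rw [hs_succ]
    simp only [he]
    omega
  · intro d
    have := hs_ge d
    change L d < s d + e d + 1
    omega
  · have := key n
    omega
  · intro n d hd
    replace hd : s d + e d + 1 = n + 1 := hd
    have h₁ := key n
    have hmem : d ∈ Finset.range (n + 1 + 1) := by
      have := hs_gt d
      rw [Finset.mem_range]
      omega
    have h₂ := Finset.single_le_sum
      (f := fun d => if s d + e d + 1 = n + 1 then 2 ^ (e d + 1) else 0) (fun _ _ => Nat.zero_le _)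
      hmem
    simp only [if_pos hd] at h₂
    have h₃ := he₁ d
    rw [show n + 2 = s d + e d + 2 by omega]
    rw [pow_succ] at h₂
    omega
  · refine eventually_atTop.2 ⟨s 0, fun n hn => ?_⟩
    have hn₁ : 1 ≤ n := by have := hs_gt 0; omega
    set S := (Finset.range (n + 1)).filter fun d => s d ≤ n with hS
    have hSne : S.Nonempty := ⟨0, by simp [hS, hn]⟩
    set d₀ := S.max' hSne with hd₀
    have hd₀S : d₀ ∈ S := S.max'_mem hSne
    have hd₀n : s d₀ ≤ n := (Finset.mem_filter.1 hd₀S).2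
    have h₁ : ∑ i ∈ Finset.range (n + 1), w i ≤
        (n + 1) + ∑ d ∈ Finset.range (n + 1), ∑ i ∈ Finset.range (n + 1),
          windowWeight (s d) (e d) i := by
      simp only [hw, Finset.sum_add_distrib, Finset.sum_const, Finset.card_range, smul_eq_mul,
        mul_one]
      rw [Finset.sum_comm (s := Finset.range (n + 1))]
      refine Nat.add_le_add_left (Finset.sum_le_sum fun i hi => ?_) _
      refine Finset.sum_le_sum_of_subset (Finset.range_subset_range.2 ?_)
      have := Finset.mem_range.1 hi
      omega
    have h₂ : ∑ d ∈ Finset.range (n + 1), ∑ i ∈ Finset.range (n + 1),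
        windowWeight (s d) (e d) i ≤ ∑ d ∈ S, 8 * c d * (n + 2) := by
      rw [hS, Finset.sum_filter]
      refine Finset.sum_le_sum fun d _ => ?_
      have h := sum_windowWeight_lt (s d) (e d) (n + 1)
      by_cases hd : s d ≤ n
      · rw [if_pos hd]
        have h' : 2 ^ min (n + 1 - s d) (e d + 1) ≤ 2 ^ (e d + 1) :=
          Nat.pow_le_pow_right (by norm_num) (min_le_right _ _)
        have h'' := he₂ d
        have h3 : c d * (s d + 2) ≤ c d * (n + 2) := Nat.mul_le_mul_left _ (by omega)
        rw [pow_succ] at h'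
        rw [mul_assoc]
        omega
      · rw [show n + 1 - s d = 0 by omega, Nat.zero_min, pow_zero] at h
        rw [if_neg hd]
        omega
    have h₃ : ∑ d ∈ S, 8 * c d ≤ κ (d₀ + 1) := by
      refine Finset.sum_le_sum_of_subset fun d hd => ?_
      have := S.le_max' d hd
      rw [Finset.mem_range]
      omega
    rw [← Finset.sum_mul] at h₂
    have h₄ : ∑ i ∈ Finset.range (n + 1), w i ≤ n * (2 + 3 * κ (d₀ + 1)) := by
      refine h₁.trans ((Nat.add_le_add_left (h₂.trans (Nat.mul_le_mul_right _ h₃)) _).trans ?_)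
      nlinarith [Nat.zero_le (κ (d₀ + 1)), Nat.mul_le_mul_left (κ (d₀ + 1)) hn₁]
    have h₅ := hg d₀ n (by have := hs_ge d₀; omega)
    calc ((∑ i ∈ Finset.range (n + 1), w i : ℕ) : ℝ) ≤ (n * (2 + 3 * κ (d₀ + 1)) : ℕ) := by
          exact_mod_cast h₄
      _ = n * (2 + 3 * (κ (d₀ + 1) : ℝ)) := by push_cast; ring
      _ ≤ n * b n := mul_le_mul_of_nonneg_left h₅ (Nat.cast_nonneg n)

/-! ### The nil algebra and its growth -/

/-- The number of conditions for elements of length at most `d` at the level `n + 1`, where `A` is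
the number of words of length at most `d`. -/
theorem card_constraints_lt (A n : ℕ) :
    A ^ 2 * (2 ^ (n + 1) + 1) ^ (A + 2) < 2 ^ ((A ^ 2 + A + 2) * (n + 2)) := by
  have h₁ : 2 ^ (n + 1) + 1 ≤ 2 ^ (n + 2) := by
    have : 1 ≤ 2 ^ (n + 1) := Nat.one_le_two_pow
    rw [pow_succ 2 (n + 1)]
    omega
  calc A ^ 2 * (2 ^ (n + 1) + 1) ^ (A + 2) < 2 ^ A ^ 2 * (2 ^ (n + 1) + 1) ^ (A + 2) :=
        Nat.mul_lt_mul_of_pos_right Nat.lt_two_pow_self (by positivity)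
    _ ≤ 2 ^ (A ^ 2 * (n + 2)) * (2 ^ (n + 2)) ^ (A + 2) :=
        Nat.mul_le_mul (Nat.pow_le_pow_right (by norm_num) (Nat.le_mul_of_pos_right _ (by omega)))
          (Nat.pow_le_pow_left h₁ _)
    _ = 2 ^ ((A ^ 2 + A + 2) * (n + 2)) := by rw [← pow_mul, ← pow_add]; congr 1; ring

/-- There is a tower whose annihilator contains a power of every element without constant term,
while the products of the first dimensions grow only slightly faster than exponentially. -/
theorem exists_nil_tower (K : Type u) [Field K] (b : ℕ → ℝ) (hb : Tendsto b atTop atTop) :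
    ∃ T : Tower K, (∀ n, 1 ≤ Module.finrank K (T.space n)) ∧
      (∀ L f, IsPositiveOfLengthLE L f → ∃ N, f ^ N ∈ T.annihilator) ∧
      ∀ᶠ n : ℕ in atTop,
        ((∏ i ∈ Finset.range (n + 1), Module.finrank K (T.space i) : ℕ) : ℝ) ≤
          (2 : ℝ) ^ ((n : ℝ) * b n) := by
  classical
  choose Y hYcard hY using fun d n =>
    exists_constraints (K := K) (shortWords d) d (2 ^ n)
  obtain ⟨w, ρ, hw₀, hρ, hLρ, hw, hwρ, hgrowth⟩ := exists_weights
    (fun d => (shortWords d).card ^ 2 + (shortWords d).card + 2) id (fun d => by omega) b hb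
  -- The conditions for elements of length at most `d` are imposed at the level `ρ d` only.
  let Z : ℕ → Finset (WordAlgebra K) := fun n =>
    if h : ∃ d, ρ d = n then Y h.choose n else ∅
  have hZρ : ∀ d, Z (ρ d) = Y d (ρ d) := by
    intro d
    have h : ∃ d', ρ d' = ρ d := ⟨d, rfl⟩
    simp only [Z]
    rw [dif_pos h, hρ h.choose_spec]
  obtain ⟨T, hT, hTZ⟩ := exists_tower (K := K) (fun n => 2 ^ w n) Z
    (by simpa using Nat.pow_le_pow_right (n := 2) (by norm_num) hw₀) (by
      intro n
      rw [← pow_mul, mul_comm]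
      by_cases h : ∃ d, ρ d = n + 1
      · obtain ⟨d, hd⟩ := h
        rw [← hd, hZρ, hd]
        have h₁ := (hYcard d (n + 1)).trans_lt (card_constraints_lt (shortWords d).card n)
        refine le_trans ?_ (Nat.pow_le_pow_right (by norm_num) (hwρ n d hd))
        rw [pow_add]
        have h₂ : 1 ≤ 2 ^ w (n + 1) := Nat.one_le_two_pow
        nlinarith
      · simp only [Z]
        rw [dif_neg h, Finset.card_empty, add_zero]
        exact Nat.pow_le_pow_right (by norm_num) (hw n))
  refine ⟨T, fun n => hT n ▸ Nat.one_le_two_pow, fun L f hf => ⟨2 ^ (ρ L + 1), ?_⟩, ?_⟩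
  · refine T.pow_mem_annihilator hf ?_ (Z := Y L (ρ L)) ?_ ?_
    · exact (hLρ L).trans Nat.lt_two_pow_self
    · exact hY L (ρ L) f fun v hv => mem_shortWords.2 (hf v hv).2
    · have hpos : ρ L ≠ 0 := (Nat.zero_lt_of_lt (hLρ L)).ne'
      obtain ⟨n, hn⟩ := Nat.exists_eq_succ_of_ne_zero hpos
      have := hTZ n
      rw [← Nat.succ_eq_add_one, ← hn, hZρ] at this
      exact this
  · filter_upwards [hgrowth] with n hn
    simp only [hT]
    rw [Finset.prod_pow_eq_pow_sum]
    push_cast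
    rw [← Real.rpow_natCast]
    exact Real.rpow_le_rpow_of_exponent_le (by norm_num) (by exact_mod_cast hn)

theorem finiteType_wordAlgebra : Algebra.FiniteType K (WordAlgebra K) := by
  let φ : FreeAlgebra K Bool →ₐ[K] WordAlgebra K :=
    FreeAlgebra.lift K fun b => word K (FreeAddMonoid.of b)
  refine Algebra.FiniteType.of_surjective φ fun f => ?_
  have hword : ∀ w, word K w ∈ LinearMap.range φ.toLinearMap := by
    intro w
    induction w using FreeAddMonoid.inductionOn' with
    | zero => exact ⟨1, map_one φ⟩
    | of_add b w ih =>
      obtain ⟨x, hx⟩ := ih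
      replace hx : φ x = word K w := hx
      refine ⟨FreeAlgebra.ι K b * x, ?_⟩
      change φ _ = _
      rw [map_mul, hx, word_add, FreeAlgebra.lift_ι_apply]
  have hf : f ∈ LinearMap.range φ.toLinearMap := by
    rw [eq_sum_words f]
    exact Submodule.sum_mem _ fun w _ => Submodule.smul_mem _ _ (hword w)
  exact hf

namespace Tower

variable (T : Tower K)

theorem exists_word_notMem_annihilator (hT : ∀ n, 1 ≤ Module.finrank K (T.space n)) (n : ℕ) :
    ∃ w, wordLength w = 2 ^ n ∧ word K w ∉ T.annihilator := by
  have hne : T.space n ≠ ⊥ := by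
    intro h
    have := hT n
    rw [h, finrank_bot] at this
    omega
  obtain ⟨g, hg, hg₀⟩ := Submodule.exists_mem_ne_zero_of_ne_bot hne
  obtain ⟨w, hw⟩ : ∃ w, g.coeff w ≠ 0 := by
    by_contra! h
    exact hg₀ (by ext w; simpa using h w)
  refine ⟨w, T.le_homog n hg w (Finsupp.mem_support_iff.2 hw), fun h => hw ?_⟩
  have := h n g hg 1 1
  rwa [one_mul, mul_one, pair_word_left] at this

theorem not_finite_quotient (hT : ∀ n, 1 ≤ Module.finrank K (T.space n)) :
    ¬ Module.Finite K (WordAlgebra K ⧸ T.annihilator) := by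
  intro hfin
  have hind := (isInternal_quotientGrading (homog K) T.annihilator
    fun r hr i => T.component_mem_annihilator hr i).submodule_iSupIndep
  have hfinite := WellFoundedGT.finite_ne_bot_of_iSupIndep hind
  refine Set.infinite_of_injective_forall_mem (Nat.pow_right_injective (le_refl 2))
    (fun n => ?_) hfinite
  obtain ⟨w, hw, hwT⟩ := T.exists_word_notMem_annihilator hT n
  intro h
  refine hwT (Ideal.Quotient.eq_zero_iff_mem.1 ?_)
  rw [← Submodule.mem_bot K, ← h]
  exact mem_quotientGrading.2 ⟨_, hw ▸ word_mem_homog w, rfl⟩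

theorem isConnectedGrading_quotient (hT : ∀ n, 1 ≤ Module.finrank K (T.space n)) :
    IsConnectedGrading (quotientGrading (homog K) T.annihilator) := by
  constructor
  · have : Nontrivial (WordAlgebra K ⧸ T.annihilator) := by
      rw [Ideal.Quotient.nontrivial_iff]
      intro h
      obtain ⟨w, -, hw⟩ := T.exists_word_notMem_annihilator hT 0
      exact hw (h ▸ Submodule.mem_top)
    exact (algebraMap K (WordAlgebra K ⧸ T.annihilator)).injective
  · rw [quotientGrading, homog_zero, Submodule.map_span, Set.image_singleton,
      ← Submodule.one_eq_range, Submodule.one_eq_span]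
    rfl

theorem isNilpotent_of_mem_positivePart
    (hnil : ∀ L f, IsPositiveOfLengthLE L f → ∃ N, f ^ N ∈ T.annihilator)
    {b : WordAlgebra K ⧸ T.annihilator}
    (hb : b ∈ positivePart (quotientGrading (homog K) T.annihilator)) : IsNilpotent b := by
  have hle : positivePart (quotientGrading (homog K) T.annihilator) ≤
      (LinearMap.ker (pair (word K 0))).map (Ideal.Quotient.mkₐ K T.annihilator).toLinearMap :=
    iSup₂_le fun n hn => Submodule.map_mono fun f hf =>
      pair_eq_zero_of_ne (i := 0) (by omega) (word_mem_homog 0) hf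
  obtain ⟨f, hf, rfl⟩ := hle hb
  have hpos : IsPositiveOfLengthLE (f.coeff.support.sup wordLength) f := by
    refine fun w hw => ⟨Nat.one_le_iff_ne_zero.2 fun h => ?_, Finset.le_sup hw⟩
    obtain rfl : w = 0 := FreeAddMonoid.length_eq_zero.1 h
    have hf₀ : pair (word K 0) f = 0 := hf
    rw [pair_word_left] at hf₀
    exact Finsupp.mem_support_iff.1 hw hf₀
  obtain ⟨N, hN⟩ := hnil _ f hpos
  refine ⟨N, ?_⟩
  change Ideal.Quotient.mk T.annihilator f ^ N = 0
  rw [← map_pow]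
  exact Ideal.Quotient.eq_zero_iff_mem.2 hN

end Tower

/-- The bound `(m + 1) * p ^ 2` on dimensions in degree `m`, with `p` a product of dimensions in a
tower, against `m ^ α m`. -/
theorem growth_bound {α : ℝ≥0 → ℝ≥0} (hα : Monotone α) {m : ℕ} (hm : 2 ≤ m) {p : ℕ}
    (hp : (p : ℝ) ≤ (2 : ℝ) ^ ((Nat.log 2 m : ℝ) *
      (((α ((2 ^ Nat.log 2 m : ℕ) : ℝ≥0) : ℝ) - 2) / 2))) :
    (((m + 1) * p ^ 2 : ℕ) : ℝ) ≤ (m : ℝ) ^ (α (m : ℝ≥0) : ℝ) := by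
  set l := Nat.log 2 m with hl
  have hl₁ : 1 ≤ l := Nat.log_pos (by norm_num) hm
  have hlm : 2 ^ l ≤ m := Nat.pow_log_le_self 2 (by omega)
  have hml : m < 2 ^ (l + 1) := Nat.lt_pow_succ_log_self (by norm_num) m
  set a : ℝ := ((α ((2 ^ l : ℕ) : ℝ≥0) : ℝ≥0) : ℝ) with ha
  have hale : a ≤ α (m : ℝ≥0) := by
    rw [ha]
    exact NNReal.coe_le_coe.2 (hα (by exact_mod_cast hlm))
  have ha₀ : 0 ≤ a := NNReal.coe_nonneg _
  have h₁ : ((m + 1 : ℕ) : ℝ) ≤ (2 : ℝ) ^ ((l : ℝ) * 2) := by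
    have : m + 1 ≤ 2 ^ (l * 2) := (Nat.succ_le_of_lt hml).trans (Nat.pow_le_pow_right (n := 2) (by norm_num) (by omega))
    calc ((m + 1 : ℕ) : ℝ) ≤ ((2 ^ (l * 2) : ℕ) : ℝ) := by exact_mod_cast this
      _ = (2 : ℝ) ^ ((l : ℝ) * 2) := by
        rw [Nat.cast_pow, ← Real.rpow_natCast]; push_cast; rfl
  have h₂ : (p : ℝ) ^ 2 ≤ (2 : ℝ) ^ ((l : ℝ) * (a - 2)) := by
    calc (p : ℝ) ^ 2 ≤ ((2 : ℝ) ^ ((l : ℝ) * ((a - 2) / 2))) ^ 2 :=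
          pow_le_pow_left₀ (Nat.cast_nonneg p) hp 2
      _ = (2 : ℝ) ^ ((l : ℝ) * (a - 2)) := by
        rw [← Real.rpow_natCast, ← Real.rpow_mul (by norm_num)]
        congr 1
        push_cast
        ring
  have hm₁ : (1 : ℝ) ≤ m := by exact_mod_cast (by omega : 1 ≤ m)
  calc (((m + 1) * p ^ 2 : ℕ) : ℝ) = ((m + 1 : ℕ) : ℝ) * (p : ℝ) ^ 2 := by push_cast; ring
    _ ≤ (2 : ℝ) ^ ((l : ℝ) * 2) * (2 : ℝ) ^ ((l : ℝ) * (a - 2)) :=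
        mul_le_mul h₁ h₂ (by positivity) (by positivity)
    _ = ((2 : ℝ) ^ (l : ℝ)) ^ a := by
        rw [← Real.rpow_add (by norm_num), ← Real.rpow_mul (by norm_num)]
        congr 1
        ring
    _ ≤ (m : ℝ) ^ a := by
        refine Real.rpow_le_rpow (by positivity) ?_ ha₀
        rw [Real.rpow_natCast]
        exact_mod_cast hlm
    _ ≤ (m : ℝ) ^ (α (m : ℝ≥0) : ℝ) := Real.rpow_le_rpow_of_exponent_le hm₁ hale

/-- Nil algebras of growth at most `n ^ α n`, for any `α` that is monotone and unbounded. -/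
theorem exists_nil_algebra (K : Type u) [Field K] (α : ℝ≥0 → ℝ≥0) (hα : Monotone α)
    (hα' : Tendsto α atTop atTop) :
    ∃ (B : Type u) (_ : Ring B) (_ : Algebra K B) (𝓑 : ℕ → Submodule K B)
      (_ : GradedAlgebra 𝓑),
      Algebra.FiniteType K B ∧
      IsConnectedGrading 𝓑 ∧
      ¬ Module.Finite K B ∧
      (∀ b ∈ positivePart 𝓑, IsNilpotent b) ∧
      (∀ n : ℕ, Module.Finite K (𝓑 n)) ∧
      ∀ᶠ n : ℕ in atTop, (Module.finrank K (𝓑 n) : ℝ) ≤ (n : ℝ) ^ (α (n : ℝ≥0) : ℝ) := by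
  -- The product of dimensions enters squared, and the factor `m + 1` costs a further `m ^ 2`.
  have hb : Tendsto (fun n : ℕ => ((α ((2 ^ n : ℕ) : ℝ≥0) : ℝ) - 2) / 2) atTop atTop := by
    refine Tendsto.atTop_div_const (by norm_num) (tendsto_atTop_add_const_right _ _ ?_)
    exact NNReal.tendsto_coe_atTop.2 (hα'.comp (tendsto_natCast_atTop_atTop.comp
      (tendsto_pow_atTop_atTop_of_one_lt (by norm_num))))
  obtain ⟨T, hT, hnil, hgrowth⟩ := exists_nil_tower K _ hb
  have := finiteType_wordAlgebra (K := K)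
  refine ⟨WordAlgebra K ⧸ T.annihilator, inferInstance, inferInstance,
    quotientGrading (homog K) T.annihilator,
    gradedAlgebraQuotient (homog K) T.annihilator fun r hr i => T.component_mem_annihilator hr i,
    Algebra.FiniteType.of_surjective (Ideal.Quotient.mkₐ K T.annihilator)
      (Ideal.Quotient.mkₐ_surjective K _),
    T.isConnectedGrading_quotient hT, T.not_finite_quotient hT,
    fun b hb => T.isNilpotent_of_mem_positivePart hnil hb, fun n => ?_, ?_⟩
  · have := finite_homog (K := K) n
    exact Module.Finite.map _ _
  · have hlog : Tendsto (Nat.log 2) atTop atTop := Filter.tendsto_atTop.2 fun k =>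
      eventually_atTop.2 ⟨2 ^ k, fun m hm => Nat.le_log_of_pow_le (by norm_num) hm⟩
    filter_upwards [hlog.eventually hgrowth, eventually_ge_atTop 2] with m hm hm₂
    refine le_trans ?_ (growth_bound hα hm₂ hm)
    exact_mod_cast T.finrank_quotientGrading_le hT (by omega)
      (Nat.lt_pow_succ_log_self (by norm_num) m)

section Growth

variable {B : Type*} [Ring B] [Algebra K B]

/-- The elements of degree at most `n` in a graded algebra. -/
def degreeLE (𝓑 : ℕ → Submodule K B) (n : ℕ) : Submodule K B :=
  ⨆ i ∈ Finset.range (n + 1), 𝓑 i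

variable {𝓑 : ℕ → Submodule K B}

theorem le_degreeLE {i n : ℕ} (h : i ≤ n) : 𝓑 i ≤ degreeLE 𝓑 n :=
  le_iSup₂_of_le (f := fun i (_ : i ∈ Finset.range (n + 1)) => 𝓑 i) i
    (Finset.mem_range.2 (by omega)) le_rfl

theorem degreeLE_mul_le [GradedAlgebra 𝓑] (m n : ℕ) :
    degreeLE 𝓑 m * degreeLE 𝓑 n ≤ degreeLE 𝓑 (m + n) := by
  rw [degreeLE, degreeLE]
  simp only [Submodule.iSup_mul, Submodule.mul_iSup]
  refine iSup₂_le fun i hi => iSup₂_le fun j hj => ?_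
  rw [Finset.mem_range] at hi hj
  exact (Submodule.mul_le.2 fun x hx y hy => SetLike.mul_mem_graded hx hy).trans
    (le_degreeLE (i := j + i) (n := m + n) (by omega))

theorem pow_le_degreeLE [GradedAlgebra 𝓑] {V : Submodule K B} {D : ℕ} (hV : V ≤ degreeLE 𝓑 D)
    (n : ℕ) : V ^ n ≤ degreeLE 𝓑 (D * n) := by
  induction n with
  | zero =>
    rw [pow_zero, Submodule.one_le]
    exact le_degreeLE (Nat.zero_le _) (SetLike.one_mem_graded 𝓑)
  | succ n ih =>
    rw [pow_succ, mul_add, mul_one]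
    exact (mul_le_mul' ih hV).trans (degreeLE_mul_le _ _)

theorem exists_le_degreeLE [GradedAlgebra 𝓑] (V : Submodule K B) [Module.Finite K V] :
    ∃ D, 1 ≤ D ∧ V ≤ degreeLE 𝓑 D := by
  classical
  obtain ⟨S, hS⟩ := Module.Finite.iff_fg.1 ‹Module.Finite K V›
  refine ⟨S.sup (fun x => (DirectSum.decompose 𝓑 x).support.sup id) + 1, by omega, ?_⟩
  rw [← hS, Submodule.span_le]
  intro x hx
  rw [← DirectSum.sum_support_decompose 𝓑 x]
  refine Submodule.sum_mem _ fun i hi => le_degreeLE ?_ (DirectSum.decompose 𝓑 x i).2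
  have h₁ := Finset.le_sup (f := fun x => (DirectSum.decompose 𝓑 x).support.sup id) hx
  have h₂ := Finset.le_sup (f := id) hi
  simp only [id] at h₁ h₂
  omega

/-- A graded algebra whose components have dimensions at most `n ^ log (1 + n)` has subexponential
growth. -/
theorem hasSubexponentialGrowth_of_finrank_le [GradedAlgebra 𝓑]
    (hfin : ∀ n, Module.Finite K (𝓑 n))
    (hdim : ∀ᶠ n : ℕ in atTop,
      (Module.finrank K (𝓑 n) : ℝ) ≤ (n : ℝ) ^ Real.log (1 + (n : ℝ))) :
    HasSubexponentialGrowth K B := by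
  intro V hVfin _ _ c hc
  obtain ⟨D, hD, hVD⟩ := exists_le_degreeLE (𝓑 := 𝓑) V
  obtain ⟨N, hN⟩ := eventually_atTop.1 hdim
  set C : ℝ := ∑ i ∈ Finset.range N, (Module.finrank K (𝓑 i) : ℝ) with hC
  have hC₀ : 0 ≤ C := Finset.sum_nonneg fun _ _ => Nat.cast_nonneg _
  have hlogc : 0 < Real.log c := Real.log_pos hc
  have hlittle : ∀ᶠ y : ℝ in atTop, Real.log (C + 1) + Real.log y + Real.log y ^ 2 ≤
      Real.log c / (D + 1) * y := by
    have h₁ : (fun y : ℝ => Real.log (C + 1) + Real.log y + Real.log y ^ 2) =o[atTop]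
        (id : ℝ → ℝ) :=
      ((Asymptotics.isLittleO_const_id_atTop _).add Real.isLittleO_log_id_atTop).add
        Real.isLittleO_pow_log_id_atTop
    filter_upwards [h₁.bound (c := Real.log c / (D + 1)) (by positivity), eventually_ge_atTop 0]
      with y hy hy₀
    rw [id, Real.norm_of_nonneg hy₀] at hy
    exact (le_abs_self _).trans hy
  have htend : Tendsto (fun n : ℕ => (D : ℝ) * n + 1) atTop atTop := by
    refine tendsto_atTop_add_const_right _ _ (Tendsto.const_mul_atTop ?_ tendsto_natCast_atTop_atTop)
    exact_mod_cast hD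
  filter_upwards [htend.eventually hlittle, eventually_ge_atTop 1] with n hn hn₁
  set y : ℝ := (D : ℝ) * n + 1 with hy
  have hn₁' : (1 : ℝ) ≤ n := by exact_mod_cast hn₁
  have hD' : (1 : ℝ) ≤ D := by exact_mod_cast hD
  have hy₁ : 1 ≤ y := by rw [hy]; nlinarith
  have hlogy : 0 ≤ Real.log y := Real.log_nonneg hy₁
  have hexp : 1 ≤ Real.exp (Real.log y ^ 2) := Real.one_le_exp (by positivity)
  obtain ⟨hF, hFle⟩ := finrank_biSup_le (Finset.range (D * n + 1)) 𝓑 hfin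
  have hdeg : ∀ i ∈ Finset.range (D * n + 1),
      (Module.finrank K (𝓑 i) : ℝ) ≤ C + Real.exp (Real.log y ^ 2) := by
    intro i hi
    rw [Finset.mem_range] at hi
    rcases lt_or_ge i N with h | h
    · have := Finset.single_le_sum (f := fun i => (Module.finrank K (𝓑 i) : ℝ))
        (fun _ _ => Nat.cast_nonneg _) (Finset.mem_range.2 h)
      linarith [Real.exp_pos (Real.log y ^ 2)]
    · have hiy : (1 + i : ℝ) ≤ y := by
        have : ((i + 1 : ℕ) : ℝ) ≤ ((D * n + 1 : ℕ) : ℝ) := by exact_mod_cast hi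
        push_cast at this
        linarith
      have h₁ : (i : ℝ) ^ Real.log (1 + (i : ℝ)) ≤ y ^ Real.log y := by
        have hi₀ : (0 : ℝ) ≤ i := Nat.cast_nonneg i
        calc (i : ℝ) ^ Real.log (1 + (i : ℝ)) ≤ y ^ Real.log (1 + (i : ℝ)) :=
              Real.rpow_le_rpow hi₀ (by linarith) (Real.log_nonneg (by linarith))
          _ ≤ y ^ Real.log y := Real.rpow_le_rpow_of_exponent_le hy₁
              (Real.log_le_log (by linarith) hiy)
      rw [Real.rpow_def_of_pos (x := y) (by linarith), ← sq] at h₁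
      linarith [hN i h]
  calc (Module.finrank K ↥(V ^ n) : ℝ) ≤ Module.finrank K (degreeLE 𝓑 (D * n)) := by
        have : Module.Finite K (degreeLE 𝓑 (D * n)) := hF
        exact_mod_cast Submodule.finrank_mono (pow_le_degreeLE hVD n)
    _ ≤ ∑ i ∈ Finset.range (D * n + 1), (Module.finrank K (𝓑 i) : ℝ) := by exact_mod_cast hFle
    _ ≤ y * (C + Real.exp (Real.log y ^ 2)) := by
        refine (Finset.sum_le_card_nsmul _ _ _ hdeg).trans (le_of_eq ?_)
        rw [Finset.card_range, nsmul_eq_mul, hy]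
        push_cast
        ring
    _ ≤ y * ((C + 1) * Real.exp (Real.log y ^ 2)) := by
        refine mul_le_mul_of_nonneg_left ?_ (by linarith)
        nlinarith
    _ = Real.exp (Real.log (C + 1) + Real.log y + Real.log y ^ 2) := by
        rw [Real.exp_add, Real.exp_add, Real.exp_log (by linarith), Real.exp_log (by linarith)]
        ring
    _ ≤ Real.exp (Real.log c * n) := by
        refine Real.exp_le_exp.2 (hn.trans ?_)
        rw [div_mul_eq_mul_div, div_le_iff₀ (by linarith), mul_assoc]
        refine mul_le_mul_of_nonneg_left ?_ hlogc.le
        rw [hy]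
        nlinarith
    _ = c ^ n := by
        rw [← Real.rpow_def_of_pos (by linarith), Real.rpow_natCast]

end Growth

theorem tendsto_toNNReal_log :
    Tendsto (fun x : ℝ≥0 => (Real.log (1 + x)).toNNReal) atTop atTop :=
  tendsto_real_toNNReal_atTop.comp (Real.tendsto_log_atTop.comp
    (tendsto_atTop_add_const_left _ _ (NNReal.tendsto_coe_atTop.2 tendsto_id)))

end NilGrowth

open NilGrowth in
theorem theorem1p1 (K : Type u) [Field K] :
    (∀ α : ℝ≥0 → ℝ≥0, Monotone α → Tendsto α atTop atTop →
      ∃ (B : Type u) (_ : Ring B) (_ : Algebra K B) (𝓑 : ℕ → Submodule K B)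
        (_ : GradedAlgebra 𝓑),
        Algebra.FiniteType K B ∧
        IsConnectedGrading 𝓑 ∧
        ¬ Module.Finite K B ∧
        (∀ b ∈ positivePart 𝓑, IsNilpotent b) ∧
        (∀ n : ℕ, Module.Finite K (𝓑 n)) ∧
        ∀ᶠ n : ℕ in atTop, (Module.finrank K (𝓑 n) : ℝ) ≤ (n : ℝ) ^ (α (n : ℝ≥0) : ℝ)) ∧
    (∃ (B : Type u) (_ : Ring B) (_ : Algebra K B) (𝓑 : ℕ → Submodule K B)
        (_ : GradedAlgebra 𝓑),
        Algebra.FiniteType K B ∧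
        IsConnectedGrading 𝓑 ∧
        ¬ Module.Finite K B ∧
        (∀ b ∈ positivePart 𝓑, IsNilpotent b) ∧
        HasSubexponentialGrowth K B) := by
  refine ⟨exists_nil_algebra K, ?_⟩
  -- `n ^ log (1 + n)` is subexponential.
  obtain ⟨B, _, _, 𝓑, _, hft, hconn, hinf, hnil, hfin, hdim⟩ :=
    exists_nil_algebra K (fun x => (Real.log (1 + x)).toNNReal) (fun x y hxy =>
      Real.toNNReal_le_toNNReal (Real.log_le_log (by positivity)
        (by exact_mod_cast add_le_add_right hxy 1))) tendsto_toNNReal_log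
  refine ⟨B, _, _, 𝓑, inferInstance, hft, hconn, hinf, hnil,
    hasSubexponentialGrowth_of_finrank_le hfin ?_⟩
  filter_upwards [hdim] with n hn
  rwa [Real.coe_toNNReal _ (Real.log_nonneg (by simp)), NNReal.coe_natCast] at hn
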